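/- A rectilinear polygon is a compact region $C\subset\mathbb{R}^2$ (the closure of its connected interior) whose boundary is a simple closed polygonal chain with axis-parallel edges, consecutive edges being perpendicular; a vertex is reflex if its interior angle is $270^\circ$. A value-density on $C$ is an integrable, non-negative, bounded function $v$ on $C$, and the corresponding value of a piece $X\subseteq C$ is $V(X)=\int_X v(x)\,dx$. A rectangular allocation of $C$ to $n$ agents is a vector $(X_1,\dots,X_n)$ of pairwise disjoint axis-parallel rectangles (products of two intervals of positive length) contained in $C$; part of $C$ may remain unallocated. Let $n\ge 1$ and $R\ge 0$ be integers. 1. Let $C$ be a rectilinear polygon with exactly $R$ reflex vertices, and let $n$ agents have value-densities $v_1,\dots,v_n$ on $C$ with values $V_1,\dots,V_n$. Then there is a rectangular allocation $(X_1,\dots,X_n)$ of $C$ with $$V_i(X_i)\ \ge\ \frac{V_i(C)}{n+R}\qquad\text{for all } i=1,\dots,n.$$ 2. The fraction $1/(n+R)$ is the largest that can be guaranteed: it is the greatest real $c$ such that for every rectilinear polygon $C$ with exactly $R$ reflex vertices and all value-densities $v_1,\dots,v_n$ on $C$ there is a rectangular allocation with $V_i(X_i)\ge c\,V_i(C)$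 for all $i$. This is shown by a staircase: the set $C=\bigcup_{k=0}^{R}[0,k+1]\times[0,R+1-k]$ is a rectilinear polygon with exactly $R$ reflex vertices, and there is a value-density on $C$ with $V(C)>0$ such that, if all $n$ agents have this value-density, then in every rectangular allocation of $C$ some agent $i$ has $V(X_i)\le V(C)/(n+R)$. -/

import Mathlib

open Set Filter Topology MeasureTheory

noncomputable section

/-- The closed polygonal chain `P` is a simple closed curve all of whose edges are axis-parallel
and whose consecutive edges are perpendicular. Two distinct edges that are not consecutive are
disjoint; consecutive ones, being perpendicular, meet only in their common vertex. -/
structure IsSimpleRectilinearChain {N : ℕ} (P : Polygon (ℝ × ℝ) N) : Prop where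
  nondegenerate : P.HasNondegenerateEdges
  perpendicular : ∀ i : Fin N,
    ((P i).1 = (P (finRotate N i)).1 ∧
        (P (finRotate N i)).2 = (P (finRotate N (finRotate N i))).2) ∨
      ((P i).2 = (P (finRotate N i)).2 ∧
        (P (finRotate N i)).1 = (P (finRotate N (finRotate N i))).1)
  simple : ∀ i j : Fin N, i ≠ j → j ≠ finRotate N i → i ≠ finRotate N j →
    Disjoint (P.edgeSet ℝ i) (P.edgeSet ℝ j)

/-- A rectilinear polygon (with its inside): a compact region of the plane, i.e. the closure of
its connected interior, whose boundary is a simple closed axis-parallel polygonal chain. -/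
structure IsRectilinearPolygon (C : Set (ℝ × ℝ)) : Prop where
  compact : IsCompact C
  regular : closure (interior C) = C
  connected : IsConnected (interior C)
  boundary : ∃ (N : ℕ) (P : Polygon (ℝ × ℝ) N),
    IsSimpleRectilinearChain P ∧ frontier C = P.boundary ℝ

/-- The reflex vertices of a rectilinear polygon: the points at which its interior angle is 270°,
i.e. near `p` the set `C` is the complement of one of the four open quadrants with apex `p`. -/
def reflexVertices (C : Set (ℝ × ℝ)) : Set (ℝ × ℝ) :=
  {p | ∃ s t : ℝ, (s = 1 ∨ s = -1) ∧ (t = 1 ∨ t = -1) ∧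
    ∀ᶠ q in 𝓝 p, (q ∈ C ↔ 0 ≤ s * (q.1 - p.1) ∨ 0 ≤ t * (q.2 - p.2))}

/-- A value-density on `C`: integrable, non-negative and bounded on `C`. -/
structure IsValueDensity (C : Set (ℝ × ℝ)) (v : ℝ × ℝ → ℝ) : Prop where
  integrable : IntegrableOn v C
  nonneg : ∀ x ∈ C, 0 ≤ v x
  bounded : ∃ M : ℝ, ∀ x ∈ C, v x ≤ M

/-- The value of the piece `X` under the value-density `v`. -/
def pieceValue (v : ℝ × ℝ → ℝ) (X : Set (ℝ × ℝ)) : ℝ := ∫ x in X, v x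

/-- An axis-parallel rectangle: a product of two intervals (open, closed or half-open) of
positive length. -/
def IsRectangle (X : Set (ℝ × ℝ)) : Prop :=
  ∃ I J : Set ℝ, I.OrdConnected ∧ J.OrdConnected ∧ I.Nontrivial ∧ J.Nontrivial ∧ X = I ×ˢ J

/-- One rectangular piece of `C` for each agent, the pieces being pairwise disjoint; part of `C`
may remain unallocated. -/
structure IsRectangularAllocation {n : ℕ} (C : Set (ℝ × ℝ)) (X : Fin n → Set (ℝ × ℝ)) :
    Prop where
  rectangle : ∀ i, IsRectangle (X i)
  subset : ∀ i, X i ⊆ C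
  disjoint : ∀ i j, i ≠ j → Disjoint (X i) (X j)

/-- The fraction `c` of the total value can be guaranteed to each of `n` agents, for every
rectilinear polygon with exactly `R` reflex vertices and all value-densities of the agents. -/
def CanGuarantee (n R : ℕ) (c : ℝ) : Prop :=
  ∀ C : Set (ℝ × ℝ), IsRectilinearPolygon C → (reflexVertices C).encard = R →
    ∀ v : Fin n → ℝ × ℝ → ℝ, (∀ i, IsValueDensity C (v i)) →
      ∃ X : Fin n → Set (ℝ × ℝ), IsRectangularAllocation C X ∧
        ∀ i, c * pieceValue (v i) C ≤ pieceValue (v i) (X i)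

/-- The staircase with `R + 1` stairs of width and height one. -/
def staircase (R : ℕ) : Set (ℝ × ℝ) :=
  ⋃ k ∈ Finset.range (R + 1), Icc (0 : ℝ) ((k : ℝ) + 1) ×ˢ Icc (0 : ℝ) ((R : ℝ) + 1 - (k : ℝ))

end

/-!
Cut the polygon along a horizontal chord at every reflex vertex. The cells of a grid through the
edges form maximal horizontal runs, and equal runs in consecutive rows stack into boxes. Two boxes
that meet along a horizontal line are separated there by a cut ending at a reflex vertex; counting
a reflex vertex for each edge of a spanning tree of the connected adjacency graph of the boxes
shows that there are at most `R + 1` of them. Call `1 / (n + R)` of an agent's total value a share.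
In each box a moving knife serves agents for as long as somebody still values the rest of the box
at a share or more, so an agent who remains unserved values the box at less than one share more
than the number of agents served there. Summing over at most `R + 1` boxes, an agent unserved at
the end would have total value less than `n + R` shares.

Conversely, give the `R + 1` corner squares of the staircase the values `1, …, 1, n`. A rectangle
in the staircase meets at most one of the corner squares, so it is worth at most one unless it
meets the last square, and the value `n` of that square does not give more than one to each of `n`
agents.
-/

section Pieces

variable {α β : Type*} [LinearOrder α] {S : Set (α × β)} {s t : α × β} {a : α}

/-- The columns of the maximal horizontal run of cells of `S` through the cell `s`. -/
def hRun (S : Set (α × β)) (s : α × β) : Set α :=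
  ordConnectedComponent {a | (a, s.2) ∈ S} s.1

lemma mem_of_mem_hRun (ha : a ∈ hRun S s) : (a, s.2) ∈ S :=
  (ordConnectedComponent_subset ha :)

lemma hRun_eq_of_mem (ha : a ∈ hRun S s) : hRun S (a, s.2) = hRun S s :=
  (ordConnectedComponent_eq ha).symm

variable [LinearOrder β]

/-- The rows to which the horizontal run through `s` extends vertically while remaining a maximal
horizontal run. -/
def vRun (S : Set (α × β)) (s : α × β) : Set β :=
  ordConnectedComponent {b | ∃ a, hRun S (a, b) = hRun S s} s.2

/-- The piece of the cell `s` in the dissection of `S` obtained by cutting horizontally at every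
reflex corner: the union of the consecutive horizontal runs that repeat the one through `s`. -/
def piece (S : Set (α × β)) (s : α × β) : Set (α × β) := hRun S s ×ˢ vRun S s

lemma mem_piece_self (hs : s ∈ S) : s ∈ piece S s :=
  ⟨self_mem_ordConnectedComponent.2 hs, self_mem_ordConnectedComponent.2 ⟨s.1, rfl⟩⟩

lemma hRun_eq_of_mem_piece (ht : t ∈ piece S s) : hRun S t = hRun S s := by
  obtain ⟨a, ha⟩ := ordConnectedComponent_subset ht.2
  rw [← ha]
  exact hRun_eq_of_mem (s := (a, t.2)) (ha ▸ ht.1)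

lemma piece_eq_of_mem (ht : t ∈ piece S s) : piece S t = piece S s := by
  have hrun := hRun_eq_of_mem_piece ht
  rw [piece, piece, vRun, vRun, hrun, ordConnectedComponent_eq ht.2]

lemma piece_eq_of_mem_hRun (hs : s ∈ S) (ha : a ∈ hRun S s) : piece S (a, s.2) = piece S s :=
  piece_eq_of_mem ⟨ha, (mem_piece_self hs).2⟩

lemma piece_subset : piece S s ⊆ S := fun t ht ↦
  mem_of_mem_hRun (s := t) (hRun_eq_of_mem_piece ht ▸ ht.1)

lemma disjoint_piece (h : piece S s ≠ piece S t) : Disjoint (piece S s) (piece S t) :=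
  disjoint_left.2 fun _ hs ht ↦ h ((piece_eq_of_mem hs).symm.trans (piece_eq_of_mem ht))

end Pieces

section ReflexBlocks

variable {S : Set (ℕ × ℕ)}

lemma mem_of_mem_of_ordConnected {I K : Set ℕ} [I.OrdConnected]
    (hK : ∀ k ∈ I, k + 1 ∈ I → (k ∈ K ↔ k + 1 ∈ K)) {a b : ℕ} (ha : a ∈ I) (hb : b ∈ I) :
    a ∈ K ↔ b ∈ K := by
  wlog hab : a ≤ b generalizing a b
  · exact (this hb ha (le_of_not_ge hab)).symm
  induction b, hab using Nat.le_induction with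
  | base => rfl
  | succ k hak ih =>
    have hk : k ∈ I := Set.OrdConnected.out ‹_› ha hb ⟨hak, k.le_succ⟩
    exact (ih hk).trans (hK k hk hb)

lemma mem_ordConnectedComponent_of_adjacent {U : Set ℕ} {i k l : ℕ}
    (hk : k ∈ ordConnectedComponent U i) (hkl : k + 1 = l ∨ l + 1 = k) (hl : l ∈ U) :
    l ∈ ordConnectedComponent U i := by
  refine mem_ordConnectedComponent_trans hk fun m hm ↦ ?_
  obtain rfl | rfl : m = k ∨ m = l := by grind [mem_uIcc]
  exacts [ordConnectedComponent_subset hk, hl]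

lemma exists_adjacent_of_ordConnectedComponent_ne {U V : Set ℕ} {i : ℕ} (hU : i ∈ U) (hV : i ∈ V)
    (hne : ordConnectedComponent U i ≠ ordConnectedComponent V i) :
    ∃ k l, (k + 1 = l ∨ l + 1 = k) ∧ k ∈ ordConnectedComponent U i ∧
      k ∈ ordConnectedComponent V i ∧ ¬ (l ∈ U ↔ l ∈ V) := by
  by_contra! hUV
  have subset {U V : Set ℕ} (hU : i ∈ U) (hV : i ∈ V)
      (hUV : ∀ k l, k + 1 = l ∨ l + 1 = k → k ∈ ordConnectedComponent U i →
        k ∈ ordConnectedComponent V i → (l ∈ U ↔ l ∈ V)) :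
      ordConnectedComponent U i ⊆ ordConnectedComponent V i := fun a ha ↦ by
    have spread {k l : ℕ} (hkl : k + 1 = l ∨ l + 1 = k) (hk : k ∈ ordConnectedComponent U i)
        (hl : l ∈ ordConnectedComponent U i) (hkV : k ∈ ordConnectedComponent V i) :
        l ∈ ordConnectedComponent V i :=
      mem_ordConnectedComponent_of_adjacent hkV hkl
        ((hUV k l hkl hk hkV).1 (ordConnectedComponent_subset hl))
    exact (mem_of_mem_of_ordConnected
      (fun k hk hk' ↦ ⟨spread (.inl rfl) hk hk', spread (.inr rfl) hk' hk⟩)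
      (self_mem_ordConnectedComponent.2 hU) ha).1 (self_mem_ordConnectedComponent.2 hV)
  exact hne <| (subset hU hV hUV).antisymm <|
    subset hV hU fun k l hkl hkV hkU ↦ (hUV k l hkl hkU hkV).symm

/-- The lower left cells of the `2 × 2` blocks of cells of which exactly one is missing from `S`:
the combinatorial counterparts of the reflex vertices. -/
def reflexBlocks (S : Set (ℕ × ℕ)) : Set (ℕ × ℕ) := {c | ∃ d, Icc c (c + (1, 1)) \ S = {d}}

open Classical in
/-- The two pieces that meet along the horizontal cut made at the reflex block `c`; they are read
off in the column of the block both of whose cells belong to `S`. -/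
noncomputable def blockEdge (S : Set (ℕ × ℕ)) (c : ℕ × ℕ) : Sym2 (Set (ℕ × ℕ)) :=
  let i := if c ∈ S ∧ c + (0, 1) ∈ S then c.1 else c.1 + 1
  s(piece S (i, c.2), piece S (i, c.2 + 1))

lemma hRun_ne_of_piece_ne {s : ℕ × ℕ} (hs : s ∈ S) (hs' : s + (0, 1) ∈ S)
    (hne : piece S s ≠ piece S (s + (0, 1))) : hRun S s ≠ hRun S (s + (0, 1)) := by
  refine fun hrun ↦ hne (piece_eq_of_mem ?_).symm
  refine ⟨hrun ▸ (mem_piece_self hs').1, ?_⟩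
  exact mem_ordConnectedComponent_of_adjacent (mem_piece_self hs).2 (.inl rfl) ⟨s.1, hrun.symm⟩

lemma mem_reflexBlocks {j k l : ℕ} (hkl : k + 1 = l ∨ l + 1 = k) (hk : (k, j) ∈ S)
    (hk' : (k, j + 1) ∈ S) (hl : ¬ ((l, j) ∈ S ↔ (l, j + 1) ∈ S)) :
    (min k l, j) ∈ reflexBlocks S := by
  obtain ⟨b, hb, hlb⟩ : ∃ b, (b = j ∨ b = j + 1) ∧
      ∀ b', b' = j ∨ b' = j + 1 → ((l, b') ∉ S ↔ b' = b) := by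
    by_cases hj : (l, j) ∈ S
    · exact ⟨j + 1, .inr rfl, by grind⟩
    · exact ⟨j, .inl rfl, by grind⟩
  refine ⟨(l, b), Set.ext fun ⟨a, b'⟩ ↦ ?_⟩
  have hcell : (a, b') ∈ Icc (min k l, j) ((min k l, j) + (1, 1)) ↔
      (a = k ∨ a = l) ∧ (b' = j ∨ b' = j + 1) := by
    simp only [mem_Icc, Prod.mk_le_mk, Prod.mk_add_mk]
    lia
  rw [Set.mem_sdiff, hcell, mem_singleton_iff, Prod.mk.injEq]
  constructor
  · rintro ⟨⟨rfl | rfl, rfl | rfl⟩, h⟩ <;> grind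
  · rintro ⟨rfl, rfl⟩
    exact ⟨⟨.inr rfl, hb⟩, (hlb _ hb).2 rfl⟩

lemma blockEdge_eq {j k l : ℕ} (hkl : k + 1 = l ∨ l + 1 = k) (hk : (k, j) ∈ S)
    (hk' : (k, j + 1) ∈ S) (hl : ¬ ((l, j) ∈ S ↔ (l, j + 1) ∈ S)) :
    blockEdge S (min k l, j) = s(piece S (k, j), piece S (k, j + 1)) := by
  rcases hkl with rfl | rfl
  · rw [min_eq_left (Nat.le_succ k), blockEdge, if_pos ⟨hk, hk'⟩]
  · rw [min_eq_right (Nat.le_succ l), blockEdge, if_neg fun h ↦ hl ⟨fun _ ↦ h.2, fun _ ↦ h.1⟩]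

lemma exists_reflexBlock_of_piece_ne {s : ℕ × ℕ} (hs : s ∈ S) (hs' : s + (0, 1) ∈ S)
    (hne : piece S s ≠ piece S (s + (0, 1))) :
    ∃ c ∈ reflexBlocks S, blockEdge S c = s(piece S s, piece S (s + (0, 1))) := by
  obtain ⟨k, l, hkl, hk, hk', hl⟩ :=
    exists_adjacent_of_ordConnectedComponent_ne (U := {a | (a, s.2) ∈ S})
      (V := {a | (a, s.2 + 1) ∈ S}) hs hs' (hRun_ne_of_piece_ne hs hs' hne)
  have hkS : (k, s.2) ∈ S := mem_of_mem_hRun hk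
  have hkS' : (k, s.2 + 1) ∈ S := mem_of_mem_hRun (s := s + (0, 1)) hk'
  refine ⟨_, mem_reflexBlocks hkl hkS hkS' hl, ?_⟩
  rw [blockEdge_eq hkl hkS hkS' hl, piece_eq_of_mem_hRun hs hk]
  exact congrArg (s(piece S s, ·)) (piece_eq_of_mem_hRun hs' hk')

end ReflexBlocks

section PieceGraph

variable {S : Set (ℕ × ℕ)}

/-- The graph whose vertices are the pieces of `S`, with an edge for every horizontal cut made at a
reflex block. -/
def pieceGraph (S : Set (ℕ × ℕ)) : SimpleGraph (piece S '' S) :=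
  SimpleGraph.fromEdgeSet (Sym2.map Subtype.val ⁻¹' (blockEdge S '' reflexBlocks S))

lemma card_edgeSet_pieceGraph_le (hfin : (reflexBlocks S).Finite) :
    Nat.card (pieceGraph S).edgeSet ≤ (reflexBlocks S).ncard := by
  have himage : (blockEdge S '' reflexBlocks S).Finite := hfin.image _
  calc (pieceGraph S).edgeSet.ncard
      ≤ (Sym2.map Subtype.val ⁻¹' (blockEdge S '' reflexBlocks S)).ncard :=
        ncard_le_ncard ((SimpleGraph.edgeSet_fromEdgeSet _).trans_subset sdiff_subset)
          (himage.preimage (Sym2.map.injective Subtype.val_injective).injOn)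
    _ ≤ (blockEdge S '' reflexBlocks S).ncard :=
        ncard_le_ncard_of_injOn _ (fun _ he ↦ he)
          (Sym2.map.injective Subtype.val_injective).injOn himage
    _ ≤ (reflexBlocks S).ncard := ncard_image_le hfin

lemma piece_eq_of_horizontal {s : ℕ × ℕ} (hs : s ∈ S) (hs' : s + (1, 0) ∈ S) :
    piece S (s + (1, 0)) = piece S s :=
  piece_eq_of_mem_hRun hs <|
    mem_ordConnectedComponent_of_adjacent (mem_piece_self hs).1 (.inl rfl) hs'

lemma reachable_pieceGraph_of_eq {s t : ℕ × ℕ} (hs : s ∈ S) (ht : t ∈ S)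
    (h : piece S s = piece S t) :
    (pieceGraph S).Reachable ⟨piece S s, s, hs, rfl⟩ ⟨piece S t, t, ht, rfl⟩ := by
  rw [Subtype.ext (a1 := ⟨piece S s, s, hs, rfl⟩) (a2 := ⟨piece S t, t, ht, rfl⟩) h]

lemma reachable_pieceGraph_of_vertical {s : ℕ × ℕ} (hs : s ∈ S) (hs' : s + (0, 1) ∈ S) :
    (pieceGraph S).Reachable ⟨piece S s, s, hs, rfl⟩ ⟨piece S (s + (0, 1)), _, hs', rfl⟩ := by
  by_cases hne : piece S s = piece S (s + (0, 1))
  · exact reachable_pieceGraph_of_eq hs hs' hne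
  · refine SimpleGraph.Adj.reachable (SimpleGraph.fromEdgeSet_adj _ |>.2 ⟨?_, ?_⟩)
    · exact exists_reflexBlock_of_piece_ne hs hs' hne
    · exact fun h ↦ hne (congrArg Subtype.val h)

lemma hasse_nat_adj {i k : ℕ} : (SimpleGraph.hasse ℕ).Adj i k ↔ i + 1 = k ∨ k + 1 = i := by
  simp only [SimpleGraph.hasse_adj, Order.covBy_iff_add_one_eq]

lemma reachable_pieceGraph_of_adj {s t : S}
    (h : ((SimpleGraph.hasse ℕ □ SimpleGraph.hasse ℕ).induce S).Adj s t) :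
    (pieceGraph S).Reachable ⟨piece S s, s, s.2, rfl⟩ ⟨piece S t, t, t.2, rfl⟩ := by
  obtain ⟨⟨i, j⟩, hs⟩ := s
  obtain ⟨⟨k, l⟩, ht⟩ := t
  simp only [SimpleGraph.comap_adj, Function.Embedding.subtype_apply, SimpleGraph.boxProd_adj,
    hasse_nat_adj] at h
  rcases h with ⟨rfl | rfl, rfl⟩ | ⟨rfl | rfl, rfl⟩
  · exact reachable_pieceGraph_of_eq hs ht (piece_eq_of_horizontal hs ht).symm
  · exact reachable_pieceGraph_of_eq hs ht (piece_eq_of_horizontal ht hs)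
  · exact reachable_pieceGraph_of_vertical hs ht
  · exact (reachable_pieceGraph_of_vertical ht hs).symm

lemma connected_pieceGraph (hS : ((SimpleGraph.hasse ℕ □ SimpleGraph.hasse ℕ).induce S).Connected) :
    (pieceGraph S).Connected := by
  obtain ⟨s⟩ := hS.nonempty
  refine (SimpleGraph.connected_iff _).2 ⟨?_, ⟨piece S s, s, s.2, rfl⟩⟩
  rintro ⟨_, s, hs, rfl⟩ ⟨_, t, ht, rfl⟩
  have hst := (SimpleGraph.reachable_iff_reflTransGen _ _).1 (hS.preconnected ⟨s, hs⟩ ⟨t, ht⟩)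
  rw [SimpleGraph.reachable_iff_reflTransGen]
  refine hst.lift' (fun s : S ↦ (⟨piece S s, s, s.2, rfl⟩ : piece S '' S)) fun _ _ h ↦ ?_
  exact (SimpleGraph.reachable_iff_reflTransGen _ _).1 (reachable_pieceGraph_of_adj h)

theorem ncard_pieces_le (hS : ((SimpleGraph.hasse ℕ □ SimpleGraph.hasse ℕ).induce S).Connected)
    (hfin : (reflexBlocks S).Finite) : (piece S '' S).ncard ≤ (reflexBlocks S).ncard + 1 :=
  (connected_pieceGraph hS).card_vert_le_card_edgeSet_add_one.trans <|
    Nat.add_le_add_right (card_edgeSet_pieceGraph_le hfin) 1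

end PieceGraph

section Sharing

variable {ι Ω : Type*} [MeasurableSpace Ω] {μ : ι → Measure Ω} {t : ι → ℝ} {𝓕 𝓖 : Set (Set Ω)}
  {A B : Finset ι} {U V : Set Ω} {X Y : ι → Set Ω}

/-- The agents `i ∈ A` receive disjoint pieces `X i` of `U`, taken from the family `𝓕` of admissible
pieces, each of measure at least `t i` under the measure `μ i` of its owner. -/
structure IsSharing (μ : ι → Measure Ω) (t : ι → ℝ) (𝓕 : Set (Set Ω)) (A : Finset ι) (U : Set Ω)
    (X : ι → Set Ω) : Prop where
  mem : ∀ i ∈ A, X i ∈ 𝓕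
  subset : ∀ i ∈ A, X i ⊆ U
  disjoint : (A : Set ι).PairwiseDisjoint X
  le : ∀ i ∈ A, t i ≤ (μ i).real (X i)

namespace IsSharing

lemma empty : IsSharing μ t 𝓕 ∅ U X where
  mem := by simp
  subset := by simp
  disjoint := by simp
  le := by simp

lemma singleton {i : ι} (hU : U ∈ 𝓕) (hi : t i ≤ (μ i).real U) :
    IsSharing μ t 𝓕 {i} U fun _ ↦ U where
  mem := by simpa using hU
  subset := by simp
  disjoint := by simp
  le := by simpa using hi

lemma mono (h : IsSharing μ t 𝓕 A U X) (h𝓕 : 𝓕 ⊆ 𝓖) (hU : U ⊆ V) : IsSharing μ t 𝓖 A V X where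
  mem i hi := h𝓕 (h.mem i hi)
  subset i hi := (h.subset i hi).trans hU
  disjoint := h.disjoint
  le := h.le

lemma union [DecidableEq ι] (hX : IsSharing μ t 𝓕 A U X) (hY : IsSharing μ t 𝓕 B V Y)
    (hAB : Disjoint A B) (hUV : Disjoint U V) :
    IsSharing μ t 𝓕 (A ∪ B) (U ∪ V) (A.piecewise X Y) := by
  have hA {i} (hi : i ∈ A) : A.piecewise X Y i = X i := Finset.piecewise_eq_of_mem _ _ _ hi
  have hB {i} (hi : i ∈ B) : A.piecewise X Y i = Y i :=
    Finset.piecewise_eq_of_notMem _ _ _ (Finset.disjoint_right.1 hAB hi)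
  constructor
  · exact Finset.forall_mem_union.2 ⟨fun i hi ↦ hA hi ▸ hX.mem i hi, fun i hi ↦ hB hi ▸ hY.mem i hi⟩
  · exact Finset.forall_mem_union.2
      ⟨fun i hi ↦ hA hi ▸ (hX.subset i hi).trans subset_union_left,
        fun i hi ↦ hB hi ▸ (hY.subset i hi).trans subset_union_right⟩
  · rw [Finset.coe_union, pairwiseDisjoint_union]
    refine ⟨fun i hi j hj hij ↦ ?_, fun i hi j hj hij ↦ ?_, fun i hi j hj _ ↦ ?_⟩
    · simpa only [Function.onFun, hA hi, hA hj] using hX.disjoint hi hj hij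
    · simpa only [Function.onFun, hB hi, hB hj] using hY.disjoint hi hj hij
    · simpa only [hA hi, hB hj] using hUV.mono (hX.subset i hi) (hY.subset j hj)
  · exact Finset.forall_mem_union.2 ⟨fun i hi ↦ hA hi ▸ hX.le i hi, fun i hi ↦ hB hi ▸ hY.le i hi⟩

lemma preimage_inter {Ω' : Type*} [MeasurableSpace Ω'] {μ : ι → Measure Ω'} {f : Ω' → Ω}
    {E : Set Ω'} (hf : Measurable f) (h𝓕 : ∀ I ∈ 𝓕, MeasurableSet I)
    (h : IsSharing (fun i ↦ ((μ i).restrict E).map f) t 𝓕 A U X) :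
    IsSharing μ t ((f ⁻¹' · ∩ E) '' 𝓕) A (f ⁻¹' U ∩ E) fun i ↦ f ⁻¹' X i ∩ E where
  mem i hi := mem_image_of_mem _ (h.mem i hi)
  subset i hi := inter_subset_inter_left _ (preimage_mono (h.subset i hi))
  disjoint i hi j hj hij :=
    ((h.disjoint hi hj hij).preimage f).mono inter_subset_left inter_subset_left
  le i hi := by
    have hXi : MeasurableSet (X i) := h𝓕 _ (h.mem i hi)
    have hle := h.le i hi
    rwa [map_measureReal_apply hf hXi, measureReal_restrict_apply (hf hXi)] at hle

end IsSharing

end Sharing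

section MovingKnife

variable {ι : Type*} {t : ι → ℝ} {a b : ℝ}

lemma exists_measureReal_Ioc_eq (ν : Measure ℝ) [IsLocallyFiniteMeasure ν]
    [NullSingletonClass ν] {r : ℝ} (hr : 0 < r) (hrb : r ≤ ν.real (Ioc a b)) :
    ∃ s ∈ Icc a b, ν.real (Ioc a s) = r := by
  have hab : a ≤ b := by
    by_contra! hba
    rw [Ioc_eq_empty (not_lt.2 hba.le), measureReal_empty] at hrb
    exact hr.not_ge hrb
  have hprim {s : ℝ} (hs : a ≤ s) : ∫ _ in a..s, (1 : ℝ) ∂ν = ν.real (Ioc a s) := by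
    simp [intervalIntegral.integral_const', Ioc_eq_empty (not_lt.2 hs)]
  have hcont : Continuous fun s ↦ ∫ _ in a..s, (1 : ℝ) ∂ν :=
    intervalIntegral.continuous_primitive (fun _ _ ↦ intervalIntegrable_const) a
  obtain ⟨s, hs, hsr⟩ := intermediate_value_Icc hab hcont.continuousOn
    (show r ∈ Icc _ _ by simpa [hprim hab] using ⟨hr.le, hrb⟩)
  exact ⟨s, hs, by rw [← hprim hs.1, ← hsr]⟩

lemma exists_first_cut (ν : ι → Measure ℝ) [∀ i, IsLocallyFiniteMeasure (ν i)]
    [∀ i, NullSingletonClass (ν i)] {A : Finset ι} (ht : ∀ i ∈ A, 0 < t i)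
    (hA : ∃ i ∈ A, t i ≤ (ν i).real (Ioc a b)) :
    ∃ i ∈ A, ∃ s ∈ Icc a b, t i ≤ (ν i).real (Ioc a s) ∧
      ∀ j ∈ A, (ν j).real (Ioc a s) ≤ t j := by
  classical
  have hcut (i : ι) : ∃ s, i ∈ A → t i ≤ (ν i).real (Ioc a b) →
      s ∈ Icc a b ∧ (ν i).real (Ioc a s) = t i := by
    by_cases hi : i ∈ A ∧ t i ≤ (ν i).real (Ioc a b)
    · obtain ⟨s, hs, hsi⟩ := exists_measureReal_Ioc_eq (ν i) (ht i hi.1) hi.2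
      exact ⟨s, fun _ _ ↦ ⟨hs, hsi⟩⟩
    · exact ⟨a, fun h h' ↦ (hi ⟨h, h'⟩).elim⟩
  choose cut hcut using hcut
  obtain ⟨i, hi, hmin⟩ := (A.filter fun i ↦ t i ≤ (ν i).real (Ioc a b)).exists_min_image cut
    (by simpa [Finset.Nonempty] using hA)
  rw [Finset.mem_filter] at hi
  obtain ⟨hcuti, hcuti_eq⟩ := hcut i hi.1 hi.2
  refine ⟨i, hi.1, cut i, hcuti, hcuti_eq.ge, fun j hj ↦ ?_⟩
  rcases le_or_gt (t j) ((ν j).real (Ioc a b)) with hjb | hjb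
  · rw [← (hcut j hj hjb).2]
    exact measureReal_mono (Ioc_subset_Ioc_right (hmin j (Finset.mem_filter.2 ⟨hj, hjb⟩)))
      measure_Ioc_lt_top.ne
  · exact (measureReal_mono (Ioc_subset_Ioc_right hcuti.2) measure_Ioc_lt_top.ne).trans hjb.le

theorem exists_isSharing_Ioc [DecidableEq ι] (ν : ι → Measure ℝ)
    [∀ i, IsLocallyFiniteMeasure (ν i)] [∀ i, NullSingletonClass (ν i)] {A : Finset ι}
    (ht : ∀ i ∈ A, 0 < t i) (a b : ℝ) :
    ∃ A' ⊆ A, ∃ X, IsSharing ν t {I | ∃ u v, I = Ioc u v} A' (Ioc a b) X ∧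
      ∀ j ∈ A \ A', (ν j).real (Ioc a b) < (A'.card + 1) * t j := by
  induction A using Finset.strongInduction generalizing a with
  | H A ih =>
    by_cases hA : ∃ i ∈ A, t i ≤ (ν i).real (Ioc a b)
    · obtain ⟨i, hi, s, hs, hti, hle⟩ := exists_first_cut ν ht hA
      obtain ⟨A', hA', X, hX, hlt⟩ := ih (A.erase i) (Finset.erase_ssubset hi)
        (fun j hj ↦ ht j (Finset.mem_of_mem_erase hj)) s
      have hiA' : Disjoint {i} A' :=
        Finset.disjoint_singleton_left.2 fun h ↦ Finset.notMem_erase i A (hA' h)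
      have hsplit : Ioc a s ∪ Ioc s b = Ioc a b := Ioc_union_Ioc_eq_Ioc hs.1 hs.2
      have hshare : IsSharing ν t {I | ∃ u v, I = Ioc u v} {i} (Ioc a s) fun _ ↦ Ioc a s :=
        .singleton ⟨a, s, rfl⟩ hti
      refine ⟨{i} ∪ A', Finset.union_subset (Finset.singleton_subset_iff.2 hi)
        (hA'.trans (A.erase_subset i)), _,
        hsplit ▸ hshare.union hX hiA' (Ioc_disjoint_Ioc_of_le le_rfl), fun j hj ↦ ?_⟩
      have hjrest : j ∈ A.erase i \ A' := by grind
      have hadd : (ν j).real (Ioc a b) = (ν j).real (Ioc a s) + (ν j).real (Ioc s b) := by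
        rw [← hsplit, measureReal_union (Ioc_disjoint_Ioc_of_le le_rfl) measurableSet_Ioc
          measure_Ioc_lt_top.ne measure_Ioc_lt_top.ne]
      rw [Finset.card_union_of_disjoint hiA', Finset.card_singleton, Nat.cast_add, Nat.cast_one]
      linarith [hle j (Finset.mem_sdiff.1 hj).1, hlt j hjrest]
    · push Not at hA
      exact ⟨∅, A.empty_subset, fun _ ↦ ∅, .empty, by simpa using hA⟩

end MovingKnife

section Boxes

variable {ι : Type*} {t : ι → ℝ}

/-- The half-open boxes of the plane; half-open so that a box is cut into two disjoint boxes. -/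
def boxes : Set (Set (ℝ × ℝ)) := {B | ∃ a b c d, B = Ioc a b ×ˢ Ioc c d}

lemma measurableSet_of_mem_boxes {B : Set (ℝ × ℝ)} (hB : B ∈ boxes) : MeasurableSet B := by
  obtain ⟨a, b, c, d, rfl⟩ := hB
  exact measurableSet_Ioc.prod measurableSet_Ioc

lemma nullSingletonClass_map_fst {μ : Measure (ℝ × ℝ)} (hμ : ∀ x : ℝ, μ ({x} ×ˢ univ) = 0)
    (E : Set (ℝ × ℝ)) : NullSingletonClass ((μ.restrict E).map Prod.fst) where
  measure_singleton x := by
    rw [Measure.map_apply measurable_fst (measurableSet_singleton x), ← prod_univ]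
    exact Measure.absolutelyContinuous_of_le Measure.restrict_le_self (hμ x)

variable (μ : ι → Measure (ℝ × ℝ)) [∀ i, IsFiniteMeasure (μ i)]

lemma exists_isSharing_box [DecidableEq ι] (hμ : ∀ i (x : ℝ), μ i ({x} ×ˢ univ) = 0)
    {A : Finset ι} (ht : ∀ i ∈ A, 0 < t i) {B : Set (ℝ × ℝ)} (hB : B ∈ boxes) :
    ∃ A' ⊆ A, ∃ X, IsSharing μ t boxes A' B X ∧
      ∀ j ∈ A \ A', (μ j).real B < (A'.card + 1) * t j := by
  obtain ⟨a, b, c, d, rfl⟩ := hB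
  have hprod (I : Set ℝ) : Prod.fst ⁻¹' I ∩ univ ×ˢ Ioc c d = I ×ˢ Ioc c d := by
    rw [← prod_univ, prod_inter_prod, inter_univ, univ_inter]
  have hreal (i : ι) : (((μ i).restrict (univ ×ˢ Ioc c d)).map Prod.fst).real (Ioc a b) =
      (μ i).real (Ioc a b ×ˢ Ioc c d) := by
    rw [map_measureReal_apply measurable_fst measurableSet_Ioc,
      measureReal_restrict_apply (measurable_fst measurableSet_Ioc), hprod]
  have := fun i ↦ nullSingletonClass_map_fst (hμ i) (univ ×ˢ Ioc c d)
  obtain ⟨A', hA', X, hX, hlt⟩ :=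
    exists_isSharing_Ioc (fun i ↦ ((μ i).restrict (univ ×ˢ Ioc c d)).map Prod.fst) ht a b
  refine ⟨A', hA', _, (hX.preimage_inter measurable_fst ?_).mono ?_ (hprod _).subset, ?_⟩
  · rintro _ ⟨u, v, rfl⟩
    exact measurableSet_Ioc
  · rintro _ ⟨_, ⟨u, v, rfl⟩, rfl⟩
    exact ⟨u, v, c, d, hprod _⟩
  · simpa only [hreal] using hlt

lemma exists_partial_isSharing_boxes [DecidableEq ι] (hμ : ∀ i (x : ℝ), μ i ({x} ×ˢ univ) = 0)
    {A : Finset ι} (ht : ∀ i ∈ A, 0 < t i) {𝓑 : Finset (Set (ℝ × ℝ))} (h𝓑 : 𝓑.Nonempty)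
    (hboxes : ∀ B ∈ 𝓑, B ∈ boxes) (hdisj : (𝓑 : Set (Set (ℝ × ℝ))).PairwiseDisjoint id) :
    ∃ A' ⊆ A, ∃ X, IsSharing μ t boxes A' (⋃₀ ↑𝓑) X ∧
      ∀ j ∈ A \ A', ∑ B ∈ 𝓑, (μ j).real B < (A'.card + 𝓑.card) * t j := by
  induction h𝓑 using Finset.Nonempty.cons_induction generalizing A with
  | singleton B =>
    simpa using exists_isSharing_box μ hμ ht (hboxes B (Finset.mem_singleton_self B))
  | cons B 𝓑 hB _ ih =>
    rw [Finset.forall_mem_cons] at hboxes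
    rw [Finset.coe_cons, pairwiseDisjoint_insert_of_notMem (by simpa using hB)] at hdisj
    obtain ⟨A₁, hA₁, X, hX, hX_lt⟩ := exists_isSharing_box μ hμ ht hboxes.1
    obtain ⟨A₂, hA₂, Y, hY, hY_lt⟩ :=
      ih (A := A \ A₁) (fun i hi ↦ ht i (Finset.sdiff_subset hi)) hboxes.2 hdisj.1
    have hA₁₂ : Disjoint A₁ A₂ := Finset.disjoint_sdiff.mono_right hA₂
    refine ⟨A₁ ∪ A₂, Finset.union_subset hA₁ (hA₂.trans Finset.sdiff_subset), _,
      (hX.union hY hA₁₂ (disjoint_sUnion_right.2 hdisj.2)).mono subset_rfl (by simp), fun j hj ↦ ?_⟩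
    have hj₁ := hX_lt j (by grind)
    have hj₂ := hY_lt j (by grind)
    rw [Finset.sum_cons, Finset.card_union_of_disjoint hA₁₂, Finset.card_cons]
    push_cast
    linarith

theorem exists_isSharing_boxes (hμ : ∀ i (x : ℝ), μ i ({x} ×ˢ univ) = 0)
    {A : Finset ι} (ht : ∀ i ∈ A, 0 < t i) {𝓑 : Finset (Set (ℝ × ℝ))} (h𝓑 : 𝓑.Nonempty)
    (hboxes : ∀ B ∈ 𝓑, B ∈ boxes) (hdisj : (𝓑 : Set (Set (ℝ × ℝ))).PairwiseDisjoint id)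
    (hsum : ∀ i ∈ A, (A.card + 𝓑.card - 1) * t i ≤ ∑ B ∈ 𝓑, (μ i).real B) :
    ∃ X, IsSharing μ t boxes A (⋃₀ ↑𝓑) X := by
  classical
  obtain ⟨A', hA', X, hX, hlt⟩ := exists_partial_isSharing_boxes μ hμ ht h𝓑 hboxes hdisj
  suffices hAA' : A ⊆ A' from ⟨X, hA'.antisymm hAA' ▸ hX⟩
  intro j hj
  by_contra hjA'
  have hcard : (A'.card : ℝ) + 1 ≤ A.card := mod_cast
    Finset.card_lt_card (Finset.ssubset_iff_subset_ne.2 ⟨hA', fun h ↦ hjA' (h ▸ hj)⟩)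
  have hj_lt := (hsum j hj).trans_lt (hlt j (Finset.mem_sdiff.2 ⟨hj, hjA'⟩))
  linarith [lt_of_mul_lt_mul_right hj_lt (ht j hj).le]

end Boxes

section Grids

/-- A compact region of the plane with connected interior whose frontier lies on finitely many
horizontal and vertical lines. Unlike for a rectilinear polygon, the frontier may have several
components. -/
structure IsRectilinearRegion (C : Set (ℝ × ℝ)) : Prop where
  isCompact : IsCompact C
  isConnected_interior : IsConnected (interior C)
  exists_lines : ∃ s t : Set ℝ, s.Finite ∧ t.Finite ∧ ∀ p ∈ frontier C, p.1 ∈ s ∨ p.2 ∈ t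

lemma fst_eq_or_snd_eq_of_mem_edgeSet {N : ℕ} {P : Polygon (ℝ × ℝ) N}
    (hP : IsSimpleRectilinearChain P) {i : Fin N} {p : ℝ × ℝ} (hp : p ∈ P.edgeSet ℝ i) :
    p.1 = (P i).1 ∨ p.2 = (P i).2 := by
  obtain ⟨t, -, rfl⟩ := hp
  refine (hP.perpendicular i).imp (fun h ↦ ?_) fun h ↦ ?_ <;> simp [AffineMap.lineMap_apply, h.1]

lemma IsRectilinearPolygon.isRectilinearRegion {C : Set (ℝ × ℝ)} (hC : IsRectilinearPolygon C) :
    IsRectilinearRegion C where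
  isCompact := hC.compact
  isConnected_interior := hC.connected
  exists_lines := by
    obtain ⟨N, P, hP, hfrontier⟩ := hC.boundary
    refine ⟨range fun i ↦ (P i).1, range fun i ↦ (P i).2, finite_range _, finite_range _,
      fun p hp ↦ ?_⟩
    obtain ⟨i, hi⟩ := mem_iUnion.1 (hfrontier ▸ hp)
    exact (fst_eq_or_snd_eq_of_mem_edgeSet hP hi).imp (⟨i, ·.symm⟩) (⟨i, ·.symm⟩)

/-- The sequences `x` and `y` of breakpoints form a grid that covers `C` and whose lines contain
the frontier of `C`. -/
structure IsGridFor (C : Set (ℝ × ℝ)) (x y : ℕ → ℝ) : Prop where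
  strictMono_fst : StrictMono x
  strictMono_snd : StrictMono y
  tendsto_fst : Tendsto x atTop atTop
  tendsto_snd : Tendsto y atTop atTop
  lt_fst : ∀ p ∈ C, x 0 < p.1
  lt_snd : ∀ p ∈ C, y 0 < p.2
  frontier_subset : ∀ p ∈ frontier C, p.1 ∈ range x ∨ p.2 ∈ range y

lemma exists_strictMono_subset_range (s : Finset ℝ) :
    ∀ a, (∀ u ∈ s, a < u) →
      ∃ x : ℕ → ℝ, StrictMono x ∧ Tendsto x atTop atTop ∧ x 0 = a ∧ ↑s ⊆ range x := by
  induction s using Finset.induction_on_min with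
  | empty =>
    exact fun a _ ↦ ⟨fun n ↦ a + n, fun m n h ↦ by simpa using h,
      tendsto_atTop_add_const_left _ _ tendsto_natCast_atTop_atTop, by simp, by simp⟩
  | insert b s hb ih =>
    intro a ha
    obtain ⟨x, hx, hx_top, hx0, hsx⟩ := ih b hb
    refine ⟨fun n ↦ Nat.casesOn n a x, strictMono_nat_of_lt_succ ?_,
      (tendsto_add_atTop_iff_nat 1).1 hx_top, rfl, ?_⟩
    · rintro (_ | n)
      exacts [(ha b (s.mem_insert_self b)).trans_eq hx0.symm, hx n.lt_succ_self]
    · rw [Finset.coe_insert, insert_subset_iff]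
      refine ⟨⟨1, hx0⟩, fun u hu ↦ ?_⟩
      obtain ⟨n, hn⟩ := hsx hu
      exact ⟨n + 1, hn⟩

lemma exists_breakpoints {K s : Set ℝ} (hK : BddBelow K) (hs : s.Finite) :
    ∃ x : ℕ → ℝ, StrictMono x ∧ Tendsto x atTop atTop ∧ (∀ u ∈ K, x 0 < u) ∧ s ⊆ range x := by
  obtain ⟨b, hb⟩ := hK.union hs.bddBelow
  obtain ⟨x, hx, hx_top, hx0, hsx⟩ := exists_strictMono_subset_range hs.toFinset (b - 1)
    fun u hu ↦ (sub_one_lt b).trans_le (hb (.inr (hs.mem_toFinset.1 hu)))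
  refine ⟨x, hx, hx_top, fun u hu ↦ ?_, by simpa using hsx⟩
  exact hx0 ▸ (sub_one_lt b).trans_le (hb (.inl hu))

lemma IsRectilinearRegion.exists_isGridFor {C : Set (ℝ × ℝ)} (hC : IsRectilinearRegion C) :
    ∃ x y, IsGridFor C x y := by
  obtain ⟨s, t, hs, ht, hst⟩ := hC.exists_lines
  obtain ⟨x, hx, hx_top, hCx, hsx⟩ :=
    exists_breakpoints (hC.isCompact.image continuous_fst).bddBelow hs
  obtain ⟨y, hy, hy_top, hCy, hty⟩ :=
    exists_breakpoints (hC.isCompact.image continuous_snd).bddBelow ht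
  exact ⟨x, y, hx, hy, hx_top, hy_top, fun p hp ↦ hCx _ (mem_image_of_mem _ hp),
    fun p hp ↦ hCy _ (mem_image_of_mem _ hp), fun p hp ↦ (hst p hp).imp (@hsx _) (@hty _)⟩

/-- The open cell in column `s.1` and row `s.2` of the grid with breakpoints `x` and `y`. -/
def openCell (x y : ℕ → ℝ) (s : ℕ × ℕ) : Set (ℝ × ℝ) :=
  Ioo (x s.1) (x (s.1 + 1)) ×ˢ Ioo (y s.2) (y (s.2 + 1))

/-- The closed cell in column `s.1` and row `s.2` of the grid with breakpoints `x` and `y`. -/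
def closedCell (x y : ℕ → ℝ) (s : ℕ × ℕ) : Set (ℝ × ℝ) :=
  Icc (x s.1) (x (s.1 + 1)) ×ˢ Icc (y s.2) (y (s.2 + 1))

/-- The half-open cell in column `s.1` and row `s.2` of the grid with breakpoints `x` and `y`; the
half-open cells are pairwise disjoint and cover the upper right quadrant at `(x 0, y 0)`. -/
def halfOpenCell (x y : ℕ → ℝ) (s : ℕ × ℕ) : Set (ℝ × ℝ) :=
  Ioc (x s.1) (x (s.1 + 1)) ×ˢ Ioc (y s.2) (y (s.2 + 1))

/-- The cells of the grid with breakpoints `x` and `y` that are contained in `C`. -/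
def cellsOf (C : Set (ℝ × ℝ)) (x y : ℕ → ℝ) : Set (ℕ × ℕ) := {s | openCell x y s ⊆ C}

lemma isOpen_openCell (x y : ℕ → ℝ) (s : ℕ × ℕ) : IsOpen (openCell x y s) :=
  isOpen_Ioo.prod isOpen_Ioo

lemma isClosed_closedCell (x y : ℕ → ℝ) (s : ℕ × ℕ) : IsClosed (closedCell x y s) :=
  isClosed_Icc.prod isClosed_Icc

lemma openCell_subset_closedCell (x y : ℕ → ℝ) (s : ℕ × ℕ) : openCell x y s ⊆ closedCell x y s :=
  Set.prod_mono Ioo_subset_Icc_self Ioo_subset_Icc_self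

lemma halfOpenCell_subset_closedCell (x y : ℕ → ℝ) (s : ℕ × ℕ) :
    halfOpenCell x y s ⊆ closedCell x y s :=
  Set.prod_mono Ioc_subset_Icc_self Ioc_subset_Icc_self

section Breakpoints

variable {x : ℕ → ℝ} {i k : ℕ} {u : ℝ}

lemma notMem_range_of_mem_Ioo (hx : StrictMono x) (hu : u ∈ Ioo (x i) (x (i + 1))) :
    u ∉ range x := by
  rintro ⟨k, rfl⟩
  have hik := hx.lt_iff_lt.1 hu.1
  have hki := hx.lt_iff_lt.1 hu.2
  lia

lemma le_succ_of_mem_Icc (hx : StrictMono x) (hi : u ∈ Icc (x i) (x (i + 1)))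
    (hk : u ∈ Icc (x k) (x (k + 1))) : k ≤ i + 1 :=
  hx.le_iff_le.1 (hk.1.trans hi.2)

lemma eq_of_mem_Ioc (hx : StrictMono x) (hi : u ∈ Ioc (x i) (x (i + 1)))
    (hk : u ∈ Ioc (x k) (x (k + 1))) : i = k := by
  have hki := hx.lt_iff_lt.1 (hk.1.trans_le hi.2)
  have hik := hx.lt_iff_lt.1 (hi.1.trans_le hk.2)
  lia

lemma exists_mem_Ioc_of_tendsto (hx : Monotone x) (hx_top : Tendsto x atTop atTop) (hu : x 0 < u) :
    ∃ i, u ∈ Ioc (x i) (x (i + 1)) := by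
  obtain ⟨n, hn⟩ := (hx_top.eventually_ge_atTop u).exists
  have hu' : u ∈ ⋃ i ∈ Ico 0 n, Ioc (x i) (x (i + 1)) :=
    (hx.biUnion_Ico_Ioc_map_succ 0 n).ge ⟨hu, hn⟩
  simp only [mem_iUnion] at hu'
  obtain ⟨i, -, hi⟩ := hu'
  exact ⟨i, hi⟩

lemma exists_eq_Ico_of_ordConnected {I : Set ℕ} (hI : I.OrdConnected) (hfin : I.Finite) :
    ∃ m n, I = Ico m n := by
  rcases I.eq_empty_or_nonempty with rfl | hne
  · exact ⟨0, 0, (Ico_self 0).symm⟩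
  · refine ⟨sInf I, sSup I + 1, Set.ext fun k ↦ ⟨fun hk ↦ ?_, fun hk ↦ ?_⟩⟩
    · exact ⟨Nat.sInf_le hk, Nat.lt_succ_of_le (le_csSup hfin.bddAbove hk)⟩
    · exact hI.out (Nat.sInf_mem hne) (Nat.sSup_mem hne hfin.bddAbove)
        ⟨hk.1, Nat.le_of_lt_succ hk.2⟩

lemma exists_biUnion_Ioc_eq (hx : Monotone x) {I : Set ℕ} (hI : I.OrdConnected) (hfin : I.Finite) :
    ∃ a b, ⋃ i ∈ I, Ioc (x i) (x (i + 1)) = Ioc a b := by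
  obtain ⟨m, n, rfl⟩ := exists_eq_Ico_of_ordConnected hI hfin
  exact ⟨_, _, hx.biUnion_Ico_Ioc_map_succ m n⟩

lemma exists_sign_of_mem_Icc (hk : k ∈ Icc i (i + 1)) :
    ∃ s : ℝ, (s = 1 ∨ s = -1) ∧ ∀ u ∈ Ioo (x i) (x (i + 2)),
      (s * (u - x (i + 1)) < 0 → u ∈ Ioo (x k) (x (k + 1))) ∧
      ∃ l ∈ Icc i (i + 1), u ∈ Icc (x l) (x (l + 1)) ∧ (0 ≤ s * (u - x (i + 1)) → l ≠ k) := by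
  have hi : i ∈ Icc i (i + 1) := ⟨le_rfl, i.le_succ⟩
  have hi' : i + 1 ∈ Icc i (i + 1) := ⟨i.le_succ, le_rfl⟩
  obtain rfl | rfl : k = i ∨ k = i + 1 := by grind
  · refine ⟨1, .inl rfl, fun u hu ↦ ⟨fun h ↦ ⟨hu.1, by linarith⟩, ?_⟩⟩
    rcases le_or_gt (x (k + 1)) u with hxu | hxu
    · exact ⟨k + 1, hi', ⟨hxu, hu.2.le⟩, fun _ ↦ k.succ_ne_self⟩
    · exact ⟨k, hi, ⟨hu.1.le, hxu.le⟩, fun h ↦ by linarith⟩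
  · refine ⟨-1, .inr rfl, fun u hu ↦ ⟨fun h ↦ ⟨by linarith, hu.2⟩, ?_⟩⟩
    rcases le_or_gt u (x (i + 1)) with hux | hux
    · exact ⟨i, hi, ⟨hu.1.le, hux⟩, fun _ ↦ i.lt_succ_self.ne⟩
    · exact ⟨i + 1, hi', ⟨hux.le, hu.2.le⟩, fun h ↦ by linarith⟩

end Breakpoints

lemma inter_frontier_nonempty_of_isPreconnected {X : Type*} [TopologicalSpace X] {U C : Set X}
    (hU : IsPreconnected U) (hUC : (U ∩ C).Nonempty) (hUC' : (U ∩ Cᶜ).Nonempty) :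
    (U ∩ frontier C).Nonempty := by
  rw [frontier_eq_closure_inter_closure]
  refine isPreconnected_closed_iff.1 hU _ _ isClosed_closure isClosed_closure ?_
    (hUC.mono (inter_subset_inter_right _ subset_closure))
    (hUC'.mono (inter_subset_inter_right _ subset_closure))
  exact fun p _ ↦ (em (p ∈ C)).imp (@subset_closure _ _ _ p) (@subset_closure _ _ Cᶜ p)

lemma reflTransGen_of_isPreconnected {X ι : Type*} [TopologicalSpace X] [Finite ι] {U : Set X}
    (hU : IsPreconnected U) {F : ι → Set X} (hF : ∀ i, IsClosed (F i)) (hUF : U ⊆ ⋃ i, F i)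
    (hne : ∀ i, (U ∩ F i).Nonempty) (i j : ι) :
    Relation.ReflTransGen (fun k l ↦ (U ∩ (F k ∩ F l)).Nonempty) i j := by
  set K : Set ι := {k | Relation.ReflTransGen (fun k l ↦ (U ∩ (F k ∩ F l)).Nonempty) i k}
  by_contra hj
  have meets {k : ι} {L : Set ι} (hk : k ∈ L) : (U ∩ ⋃ l ∈ L, F l).Nonempty :=
    (hne k).mono (inter_subset_inter_right _ (subset_biUnion_of_mem hk))
  have hcover : U ⊆ (⋃ k ∈ K, F k) ∪ ⋃ k ∈ Kᶜ, F k := by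
    rwa [← biUnion_union, union_compl_self, biUnion_univ]
  obtain ⟨p, hpU, hpK, hpK'⟩ := isPreconnected_closed_iff.1 hU _ _
    (K.toFinite.isClosed_biUnion fun k _ ↦ hF k) (Kᶜ.toFinite.isClosed_biUnion fun k _ ↦ hF k)
    hcover (meets (k := i) .refl) (meets (k := j) hj)
  simp only [mem_iUnion, exists_prop] at hpK hpK'
  obtain ⟨k, hk, hpk⟩ := hpK
  obtain ⟨l, hl, hpl⟩ := hpK'
  exact hl (Relation.ReflTransGen.tail hk ⟨p, hpU, hpk, hpl⟩)

namespace IsGridFor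

variable {C : Set (ℝ × ℝ)} {x y : ℕ → ℝ} {s t : ℕ × ℕ} {p : ℝ × ℝ}

lemma closure_openCell (h : IsGridFor C x y) : closure (openCell x y s) = closedCell x y s := by
  rw [openCell, closure_prod_eq, closure_Ioo (h.strictMono_fst s.1.lt_succ_self).ne,
    closure_Ioo (h.strictMono_snd s.2.lt_succ_self).ne, closedCell]

lemma openCell_nonempty (h : IsGridFor C x y) : (openCell x y s).Nonempty :=
  (nonempty_Ioo.2 (h.strictMono_fst s.1.lt_succ_self)).prod
    (nonempty_Ioo.2 (h.strictMono_snd s.2.lt_succ_self))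

lemma disjoint_openCell_frontier (h : IsGridFor C x y) :
    Disjoint (openCell x y s) (frontier C) :=
  disjoint_left.2 fun p hp hpC ↦ (h.frontier_subset p hpC).elim
    (notMem_range_of_mem_Ioo h.strictMono_fst hp.1) (notMem_range_of_mem_Ioo h.strictMono_snd hp.2)

lemma mem_cellsOf_of_nonempty_inter (h : IsGridFor C x y) (hs : (openCell x y s ∩ C).Nonempty) :
    s ∈ cellsOf C x y := by
  have hconn : IsPreconnected (openCell x y s) := isPreconnected_Ioo.prod isPreconnected_Ioo
  by_contra hsub
  obtain ⟨p, hp, hpC⟩ :=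
    inter_frontier_nonempty_of_isPreconnected hconn hs (not_subset.1 hsub)
  exact disjoint_left.1 h.disjoint_openCell_frontier hp hpC

lemma closedCell_subset (h : IsGridFor C x y) (hC : IsClosed C) (hs : s ∈ cellsOf C x y) :
    closedCell x y s ⊆ C :=
  h.closure_openCell ▸ closure_minimal hs hC

lemma mem_cellsOf_of_mem_interior (h : IsGridFor C x y) (hp : p ∈ interior C)
    (hps : p ∈ closedCell x y s) : s ∈ cellsOf C x y := by
  rw [← h.closure_openCell] at hps
  obtain ⟨q, hqC, hqs⟩ := mem_closure_iff.1 hps _ isOpen_interior hp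
  exact h.mem_cellsOf_of_nonempty_inter ⟨q, hqs, interior_subset hqC⟩

lemma exists_mem_halfOpenCell (h : IsGridFor C x y) (hp : p ∈ C) : ∃ s, p ∈ halfOpenCell x y s := by
  obtain ⟨i, hi⟩ :=
    exists_mem_Ioc_of_tendsto h.strictMono_fst.monotone h.tendsto_fst (h.lt_fst p hp)
  obtain ⟨j, hj⟩ :=
    exists_mem_Ioc_of_tendsto h.strictMono_snd.monotone h.tendsto_snd (h.lt_snd p hp)
  exact ⟨(i, j), hi, hj⟩

lemma finite_cellsOf (h : IsGridFor C x y) (hC : IsCompact C) : (cellsOf C x y).Finite := by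
  obtain ⟨b, hb⟩ := (hC.image continuous_fst).bddAbove
  obtain ⟨c, hc⟩ := (hC.image continuous_snd).bddAbove
  obtain ⟨m, hm⟩ := (h.tendsto_fst.eventually_ge_atTop b).exists
  obtain ⟨n, hn⟩ := (h.tendsto_snd.eventually_ge_atTop c).exists
  refine ((finite_Iio m).prod (finite_Iio n)).subset fun s hs ↦ ?_
  obtain ⟨p, hp⟩ := h.openCell_nonempty (s := s)
  have hpm : p.1 ≤ x m := (hb (mem_image_of_mem _ (hs hp))).trans hm
  have hpn : p.2 ≤ y n := (hc (mem_image_of_mem _ (hs hp))).trans hn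
  exact ⟨h.strictMono_fst.lt_iff_lt.1 (hp.1.1.trans_le hpm),
    h.strictMono_snd.lt_iff_lt.1 (hp.2.1.trans_le hpn)⟩

lemma exists_mem_cellsOf (h : IsGridFor C x y) (hp : p ∈ interior C) :
    ∃ s ∈ cellsOf C x y, p ∈ closedCell x y s := by
  obtain ⟨s, hs⟩ := h.exists_mem_halfOpenCell (interior_subset hp)
  have hs' := halfOpenCell_subset_closedCell x y s hs
  exact ⟨s, h.mem_cellsOf_of_mem_interior hp hs', hs'⟩

lemma interior_inter_closedCell_nonempty (h : IsGridFor C x y) (hs : s ∈ cellsOf C x y) :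
    (interior C ∩ closedCell x y s).Nonempty := by
  obtain ⟨p, hp⟩ := h.openCell_nonempty (s := s)
  exact ⟨p, interior_maximal hs (isOpen_openCell x y s) hp, openCell_subset_closedCell x y s hp⟩

lemma reachable_of_mem_closedCell (h : IsGridFor C x y) (hp : p ∈ interior C)
    (hs : p ∈ closedCell x y s) (ht : p ∈ closedCell x y t) :
    ((SimpleGraph.hasse ℕ □ SimpleGraph.hasse ℕ).induce (cellsOf C x y)).Reachable
      ⟨s, h.mem_cellsOf_of_mem_interior hp hs⟩ ⟨t, h.mem_cellsOf_of_mem_interior hp ht⟩ := by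
  have reachable_of_adj {a b : cellsOf C x y} (hab : a = b ∨
      (SimpleGraph.hasse ℕ □ SimpleGraph.hasse ℕ).Adj a b) :
      ((SimpleGraph.hasse ℕ □ SimpleGraph.hasse ℕ).induce (cellsOf C x y)).Reachable a b := by
    rcases hab with rfl | hab
    exacts [.rfl, SimpleGraph.Adj.reachable hab]
  have hst := le_succ_of_mem_Icc h.strictMono_fst hs.1 ht.1
  have hts := le_succ_of_mem_Icc h.strictMono_fst ht.1 hs.1
  have hst' := le_succ_of_mem_Icc h.strictMono_snd hs.2 ht.2
  have hts' := le_succ_of_mem_Icc h.strictMono_snd ht.2 hs.2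
  -- The cell in the column of `t` and the row of `s` contains `p` too.
  refine (reachable_of_adj (b := ⟨(t.1, s.2), h.mem_cellsOf_of_mem_interior hp ⟨ht.1, hs.2⟩⟩)
    ?_).trans (reachable_of_adj ?_) <;>
  · simp only [Subtype.mk.injEq, Prod.ext_iff, SimpleGraph.boxProd_adj, hasse_nat_adj]
    lia

theorem connected_cellsOf (h : IsGridFor C x y) (hC : IsCompact C)
    (hconn : IsConnected (interior C)) :
    ((SimpleGraph.hasse ℕ □ SimpleGraph.hasse ℕ).induce (cellsOf C x y)).Connected := by
  have : Finite (cellsOf C x y) := (h.finite_cellsOf hC).to_subtype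
  obtain ⟨p, hp⟩ := hconn.nonempty
  obtain ⟨s, hs, -⟩ := h.exists_mem_cellsOf hp
  refine (SimpleGraph.connected_iff _).2 ⟨fun a b ↦ ?_, ⟨s, hs⟩⟩
  have hab := reflTransGen_of_isPreconnected hconn.isPreconnected
    (F := fun s : cellsOf C x y ↦ closedCell x y s) (fun _ ↦ isClosed_closedCell x y _)
    (fun q hq ↦ by simpa using h.exists_mem_cellsOf hq)
    (fun s ↦ h.interior_inter_closedCell_nonempty s.2) a b
  rw [SimpleGraph.reachable_iff_reflTransGen]
  refine hab.lift' id fun _ _ ⟨q, hqC, hqa, hqb⟩ ↦ ?_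
  exact (SimpleGraph.reachable_iff_reflTransGen _ _).1 (h.reachable_of_mem_closedCell hqC hqa hqb)

lemma mem_reflexVertices (h : IsGridFor C x y) (hC : IsClosed C) {c : ℕ × ℕ}
    (hc : c ∈ reflexBlocks (cellsOf C x y)) : (x (c.1 + 1), y (c.2 + 1)) ∈ reflexVertices C := by
  obtain ⟨d, hd⟩ := hc
  have hdc : d ∈ Icc c (c + (1, 1)) \ cellsOf C x y := hd ▸ mem_singleton d
  have mem_of_ne {e : ℕ × ℕ} (he : e ∈ Icc c (c + (1, 1))) (hed : e ≠ d) : e ∈ cellsOf C x y :=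
    by_contra fun he' ↦ hed (hd.le ⟨he, he'⟩)
  obtain ⟨a, ha, hx⟩ := exists_sign_of_mem_Icc (x := x) ⟨hdc.1.1.1, hdc.1.2.1⟩
  obtain ⟨b, hb, hy⟩ := exists_sign_of_mem_Icc (x := y) ⟨hdc.1.1.2, hdc.1.2.2⟩
  have hnhds : Ioo (x c.1) (x (c.1 + 2)) ×ˢ Ioo (y c.2) (y (c.2 + 2)) ∈
      𝓝 (x (c.1 + 1), y (c.2 + 1)) :=
    prod_mem_nhds (Ioo_mem_nhds (h.strictMono_fst (by lia)) (h.strictMono_fst (by lia)))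
      (Ioo_mem_nhds (h.strictMono_snd (by lia)) (h.strictMono_snd (by lia)))
  refine ⟨a, b, ha, hb, ?_⟩
  filter_upwards [hnhds] with q ⟨hq1, hq2⟩
  obtain ⟨hq1_lt, k, hk, hqk, hkd⟩ := hx q.1 hq1
  obtain ⟨hq2_lt, l, hl, hql, hld⟩ := hy q.2 hq2
  constructor
  · contrapose!
    exact fun hq hqC ↦
      hdc.2 (h.mem_cellsOf_of_nonempty_inter ⟨q, ⟨hq1_lt hq.1, hq2_lt hq.2⟩, hqC⟩)
  · intro hq
    have hne : (k, l) ≠ d := by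
      rintro rfl
      exact hq.elim (hkd · rfl) (hld · rfl)
    exact h.closedCell_subset hC (mem_of_ne ⟨⟨hk.1, hl.1⟩, hk.2, hl.2⟩ hne) ⟨hqk, hql⟩

lemma encard_reflexBlocks_le (h : IsGridFor C x y) (hC : IsClosed C) :
    (reflexBlocks (cellsOf C x y)).encard ≤ (reflexVertices C).encard := by
  have hinj : Function.Injective fun c : ℕ × ℕ ↦ (x (c.1 + 1), y (c.2 + 1)) := fun c c' hcc ↦
    Prod.ext (Nat.succ_injective (h.strictMono_fst.injective (Prod.ext_iff.1 hcc).1))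
      (Nat.succ_injective (h.strictMono_snd.injective (Prod.ext_iff.1 hcc).2))
  rw [← hinj.encard_image]
  exact encard_le_encard (image_subset_iff.2 fun c hc ↦ h.mem_reflexVertices hC hc)

end IsGridFor

/-- The union of the half-open cells in `K` of the grid with breakpoints `x` and `y`. -/
def cellUnion (x y : ℕ → ℝ) (K : Set (ℕ × ℕ)) : Set (ℝ × ℝ) := ⋃ s ∈ K, halfOpenCell x y s

section CellUnion

variable {x y : ℕ → ℝ} {K L : Set (ℕ × ℕ)}

lemma cellUnion_mem_boxes (hx : Monotone x) (hy : Monotone y) {I J : Set ℕ} (hI : I.OrdConnected)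
    (hJ : J.OrdConnected) (hI' : I.Finite) (hJ' : J.Finite) : cellUnion x y (I ×ˢ J) ∈ boxes := by
  obtain ⟨a, b, hab⟩ := exists_biUnion_Ioc_eq hx hI hI'
  obtain ⟨c, d, hcd⟩ := exists_biUnion_Ioc_eq hy hJ hJ'
  refine ⟨a, b, c, d, ?_⟩
  rw [← hab, ← hcd, iUnion₂_prod_const, cellUnion, biUnion_prod']
  simp only [prod_iUnion, halfOpenCell]

lemma disjoint_cellUnion (hx : StrictMono x) (hy : StrictMono y) (h : Disjoint K L) :
    Disjoint (cellUnion x y K) (cellUnion x y L) := by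
  simp only [cellUnion, disjoint_iUnion₂_left, disjoint_iUnion₂_right]
  refine fun t ht s hs ↦ disjoint_left.2 fun p hps hpt ↦ disjoint_left.1 h hs ?_
  rwa [Prod.ext (eq_of_mem_Ioc hx hps.1 hpt.1) (eq_of_mem_Ioc hy hps.2 hpt.2)]

lemma sUnion_cellUnion_pieces (x y : ℕ → ℝ) (S : Set (ℕ × ℕ)) :
    ⋃₀ (cellUnion x y '' (piece S '' S)) = cellUnion x y S := by
  have hS : ⋃ s ∈ S, piece S s = S :=
    (iUnion₂_subset fun _ _ ↦ piece_subset).antisymm fun s hs ↦ mem_biUnion hs (mem_piece_self hs)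
  simp only [sUnion_image, biUnion_image, cellUnion]
  conv_rhs => rw [← hS]
  simp only [biUnion_iUnion]

end CellUnion

namespace IsGridFor

variable {C : Set (ℝ × ℝ)} {x y : ℕ → ℝ}

lemma cellUnion_subset (h : IsGridFor C x y) (hC : IsClosed C) :
    cellUnion x y (cellsOf C x y) ⊆ C :=
  iUnion₂_subset fun s hs ↦ (halfOpenCell_subset_closedCell x y s).trans (h.closedCell_subset hC hs)

lemma volume_diff_cellUnion (h : IsGridFor C x y) :
    volume (C \ cellUnion x y (cellsOf C x y)) = 0 := by
  have hlines : volume (range x ×ˢ (univ : Set ℝ) ∪ (univ : Set ℝ) ×ˢ range y) = 0 := by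
    simp [Measure.volume_eq_prod, (countable_range x).measure_zero,
      (countable_range y).measure_zero]
  refine measure_mono_null (fun p hp ↦ ?_) hlines
  by_contra hpl
  simp only [mem_union, mem_prod, mem_univ, and_true, true_and, not_or] at hpl
  obtain ⟨s, hs⟩ := h.exists_mem_halfOpenCell hp.1
  have hps : p ∈ openCell x y s :=
    ⟨⟨hs.1.1, hs.1.2.lt_of_ne fun e ↦ hpl.1 ⟨_, e.symm⟩⟩,
      ⟨hs.2.1, hs.2.2.lt_of_ne fun e ↦ hpl.2 ⟨_, e.symm⟩⟩⟩
  exact hp.2 (mem_biUnion (h.mem_cellsOf_of_nonempty_inter ⟨p, hps, hp.1⟩) hs)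

lemma cellUnion_piece_mem_boxes (h : IsGridFor C x y) (hC : IsCompact C) {s : ℕ × ℕ}
    (hs : s ∈ cellsOf C x y) : cellUnion x y (piece (cellsOf C x y) s) ∈ boxes := by
  have hfin : (piece (cellsOf C x y) s).Finite := (h.finite_cellsOf hC).subset piece_subset
  obtain ⟨hne, hne'⟩ := prod_nonempty_iff.1 ⟨s, mem_piece_self hs⟩
  exact cellUnion_mem_boxes h.strictMono_fst.monotone h.strictMono_snd.monotone
    (inferInstanceAs (ordConnectedComponent _ _).OrdConnected)
    (inferInstanceAs (ordConnectedComponent _ _).OrdConnected) (hfin.of_prod_left hne')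
    (hfin.of_prod_right hne)

end IsGridFor

theorem IsRectilinearRegion.exists_finset_boxes {C : Set (ℝ × ℝ)} (hC : IsRectilinearRegion C)
    {R : ℕ} (hR : (reflexVertices C).encard ≤ R) :
    ∃ 𝓑 : Finset (Set (ℝ × ℝ)), 𝓑.Nonempty ∧ 𝓑.card ≤ R + 1 ∧ (∀ B ∈ 𝓑, B ∈ boxes) ∧
      (𝓑 : Set (Set (ℝ × ℝ))).PairwiseDisjoint id ∧ ⋃₀ ↑𝓑 ⊆ C ∧ volume (C \ ⋃₀ ↑𝓑) = 0 := by
  obtain ⟨x, y, h⟩ := hC.exists_isGridFor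
  set S := cellsOf C x y
  have hreflex : (reflexBlocks S).encard ≤ R :=
    (h.encard_reflexBlocks_le hC.isCompact.isClosed).trans hR
  have hconn := h.connected_cellsOf hC.isCompact hC.isConnected_interior
  have hpieces : (piece S '' S).Finite := (h.finite_cellsOf hC.isCompact).image _
  have hcard : (piece S '' S).ncard ≤ R + 1 :=
    (ncard_pieces_le hconn (finite_of_encard_le_coe hreflex)).trans
      (Nat.add_le_add_right (ENat.toNat_le_of_le_natCast hreflex) 1)
  have hboxes := hpieces.image (cellUnion x y)
  refine ⟨hboxes.toFinset, ?_, ?_, ?_, ?_, ?_, ?_⟩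
  · obtain ⟨s⟩ := hconn.nonempty
    exact (hboxes.toFinset_nonempty).2 ⟨_, _, ⟨s, s.2, rfl⟩, rfl⟩
  · exact (ncard_eq_toFinset_card _ hboxes).ge.trans ((ncard_image_le hpieces).trans hcard)
  · simp only [Finite.mem_toFinset, forall_mem_image]
    exact fun s hs ↦ h.cellUnion_piece_mem_boxes hC.isCompact hs
  · rw [Finite.coe_toFinset]
    rintro _ ⟨_, ⟨s, -, rfl⟩, rfl⟩ _ ⟨_, ⟨t, -, rfl⟩, rfl⟩ hne
    exact disjoint_cellUnion h.strictMono_fst h.strictMono_snd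
      (disjoint_piece fun hst ↦ hne (congrArg _ hst))
  · rw [Finite.coe_toFinset, sUnion_cellUnion_pieces]
    exact h.cellUnion_subset hC.isCompact.isClosed
  · rw [Finite.coe_toFinset, sUnion_cellUnion_pieces]
    exact h.volume_diff_cellUnion

end Grids

section Allocation

lemma isRectangle_of_mem_boxes {B : Set (ℝ × ℝ)} (hB : B ∈ boxes) (hne : B.Nonempty) :
    IsRectangle B := by
  obtain ⟨a, b, c, d, rfl⟩ := hB
  obtain ⟨hab, hcd⟩ := prod_nonempty_iff.1 hne
  exact ⟨_, _, ordConnected_Ioc, ordConnected_Ioc, (Ioc_infinite (nonempty_Ioc.1 hab)).nontrivial,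
    (Ioc_infinite (nonempty_Ioc.1 hcd)).nontrivial, rfl⟩

lemma IsRectangle.measurableSet {X : Set (ℝ × ℝ)} (hX : IsRectangle X) : MeasurableSet X := by
  obtain ⟨I, J, hI, hJ, -, -, rfl⟩ := hX
  exact hI.measurableSet.prod hJ.measurableSet

lemma volume_singleton_prod_univ (x : ℝ) : volume ({x} ×ˢ univ : Set (ℝ × ℝ)) = 0 := by
  rw [Measure.volume_eq_prod, Measure.prod_prod, Real.volume_singleton, zero_mul]

lemma sum_measureReal_eq_of_measure_diff_eq_zero {Ω : Type*} [MeasurableSpace Ω] {μ : Measure Ω}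
    [IsFiniteMeasure μ] {𝓑 : Finset (Set Ω)} {C : Set Ω} (hmeas : ∀ B ∈ 𝓑, MeasurableSet B)
    (hdisj : (𝓑 : Set (Set Ω)).PairwiseDisjoint id) (hsub : ⋃₀ ↑𝓑 ⊆ C)
    (hnull : μ (C \ ⋃₀ ↑𝓑) = 0) : ∑ B ∈ 𝓑, μ.real B = μ.real C :=
  calc ∑ B ∈ 𝓑, μ.real B = μ.real (⋃ B ∈ 𝓑, B) :=
        (measureReal_biUnion_finset (f := id) hdisj hmeas).symm
    _ = μ.real (⋃₀ ↑𝓑) := by rw [sUnion_eq_biUnion]; rfl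
    _ = μ.real C :=
        measureReal_congr (hsub.eventuallyLE.antisymm (ae_le_set.2 hnull))

variable {C : Set (ℝ × ℝ)} {n R : ℕ}

lemma IsRectilinearRegion.volume_ne_zero (hC : IsRectilinearRegion C) : volume C ≠ 0 :=
  ((isOpen_interior.measure_pos volume hC.isConnected_interior.nonempty).trans_le
    (measure_mono interior_subset)).ne'

lemma IsRectilinearRegion.exists_allocation_of_ne_zero (hC : IsRectilinearRegion C)
    (hR : (reflexVertices C).encard ≤ R) (μ : Fin n → Measure (ℝ × ℝ))
    [∀ i, IsFiniteMeasure (μ i)] (hμ : ∀ i, μ i ≪ volume) (hpos : ∀ i, μ i C ≠ 0) :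
    ∃ X, IsRectangularAllocation C X ∧ ∀ i, 1 / (n + R) * (μ i).real C ≤ (μ i).real (X i) := by
  obtain ⟨𝓑, h𝓑, hcard, hboxes, hdisj, hsub, hnull⟩ := hC.exists_finset_boxes hR
  have htotal (i : Fin n) : ∑ B ∈ 𝓑, (μ i).real B = (μ i).real C :=
    sum_measureReal_eq_of_measure_diff_eq_zero
      (fun B hB ↦ measurableSet_of_mem_boxes (hboxes B hB)) hdisj hsub (hμ i hnull)
  have ht (i : Fin n) : 0 < 1 / (n + R : ℝ) * (μ i).real C :=
    mul_pos (one_div_pos.2 (by have := i.pos; positivity))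
      (ENNReal.toReal_pos (hpos i) (measure_ne_top _ _))
  obtain ⟨X, hX⟩ := exists_isSharing_boxes μ (A := .univ)
    (fun i x ↦ hμ i (volume_singleton_prod_univ x)) (fun i _ ↦ ht i) h𝓑 hboxes hdisj fun i _ ↦ by
      have hn : (n : ℝ) + R ≠ 0 := by have := i.pos; positivity
      have hcard' : (𝓑.card : ℝ) ≤ R + 1 := mod_cast hcard
      calc _ ≤ (n + R : ℝ) * (1 / (n + R) * (μ i).real C) := by
            rw [Finset.card_univ, Fintype.card_fin]
            exact mul_le_mul_of_nonneg_right (by linarith) (ht i).le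
        _ = ∑ B ∈ 𝓑, (μ i).real B := by rw [htotal, ← mul_assoc, mul_one_div_cancel hn, one_mul]
  have hle (i : Fin n) := hX.le i (Finset.mem_univ i)
  refine ⟨X, ⟨fun i ↦ isRectangle_of_mem_boxes (hX.mem i (Finset.mem_univ i)) ?_,
    fun i ↦ (hX.subset i (Finset.mem_univ i)).trans hsub,
    fun i j hij ↦ hX.disjoint (Finset.mem_univ i) (Finset.mem_univ j) hij⟩, hle⟩
  rw [nonempty_iff_ne_empty]
  rintro he
  simpa [he] using (ht i).trans_le (hle i)

lemma IsRectilinearRegion.exists_allocation (hC : IsRectilinearRegion C)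
    (hR : (reflexVertices C).encard ≤ R) (μ : Fin n → Measure (ℝ × ℝ))
    [∀ i, IsFiniteMeasure (μ i)] (hμ : ∀ i, μ i ≪ volume) :
    ∃ X, IsRectangularAllocation C X ∧ ∀ i, 1 / (n + R) * (μ i).real C ≤ (μ i).real (X i) := by
  -- An agent who values `C` at zero is given the area as a value instead: a nonzero demand is what
  -- makes the pieces nonempty.
  have hreplace (i : Fin n) : ∃ ν : Measure (ℝ × ℝ), IsFiniteMeasure ν ∧ ν ≪ volume ∧ ν C ≠ 0 ∧
      (μ i C ≠ 0 → ν = μ i) := by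
    by_cases hi : μ i C = 0
    · exact ⟨volume.restrict C, isFiniteMeasure_restrict.2 hC.isCompact.measure_ne_top,
        Measure.restrict_le_self.absolutelyContinuous,
        by simpa using hC.volume_ne_zero, fun h ↦ absurd hi h⟩
    · exact ⟨μ i, inferInstance, hμ i, hi, fun _ ↦ rfl⟩
  choose ν hν hν_ac hν_ne hνμ using hreplace
  obtain ⟨X, hX, hle⟩ := hC.exists_allocation_of_ne_zero hR ν hν_ac hν_ne
  refine ⟨X, hX, fun i ↦ ?_⟩
  by_cases hi : μ i C = 0
  · rw [measureReal_def, hi, ENNReal.toReal_zero, mul_zero]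
    exact measureReal_nonneg
  · exact hνμ i hi ▸ hle i

lemma measureReal_withDensity_ofReal_eq_pieceValue {v : ℝ × ℝ → ℝ} (hv : IntegrableOn v C)
    (hv₀ : ∀ x ∈ C, 0 ≤ v x) {X : Set (ℝ × ℝ)} (hX : MeasurableSet X) (hXC : X ⊆ C) :
    ((volume.restrict C).withDensity fun q ↦ ENNReal.ofReal (v q)).real X = pieceValue v X := by
  have hv_nonneg : 0 ≤ᵐ[volume.restrict X] v :=
    (ae_restrict_mem hX).mono fun q hq ↦ hv₀ q (hXC hq)
  rw [pieceValue, integral_eq_lintegral_of_nonneg_ae hv_nonneg (hv.mono_set hXC).1,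
    measureReal_def, withDensity_apply _ hX, Measure.restrict_restrict hX, inter_eq_left.2 hXC]

/-- The guarantee of `CanGuarantee` extended to all rectilinear regions, among them polygons with
holes, with at most `R` reflex vertices, and to unbounded integrable densities. -/
def CanGuaranteeRegion (n R : ℕ) (c : ℝ) : Prop :=
  ∀ C : Set (ℝ × ℝ), IsRectilinearRegion C → (reflexVertices C).encard ≤ R →
    ∀ v : Fin n → ℝ × ℝ → ℝ, (∀ i, IntegrableOn (v i) C) → (∀ i, ∀ x ∈ C, 0 ≤ v i x) →
      ∃ X : Fin n → Set (ℝ × ℝ), IsRectangularAllocation C X ∧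
        ∀ i, c * pieceValue (v i) C ≤ pieceValue (v i) (X i)

lemma CanGuaranteeRegion.canGuarantee {c : ℝ} (h : CanGuaranteeRegion n R c) :
    CanGuarantee n R c := fun C hC hR v hv ↦
  h C hC.isRectilinearRegion hR.le v (fun i ↦ (hv i).integrable) fun i ↦ (hv i).nonneg

theorem canGuaranteeRegion_one_div (n R : ℕ) : CanGuaranteeRegion n R (1 / (n + R)) := by
  intro C hC hR v hv hv₀
  have (i : Fin n) : IsFiniteMeasure
      ((volume.restrict C).withDensity fun q ↦ ENNReal.ofReal (v i q)) :=
    isFiniteMeasure_withDensity_ofReal (hv i).2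
  obtain ⟨X, hX, hle⟩ := hC.exists_allocation hR
    (fun i ↦ (volume.restrict C).withDensity fun q ↦ ENNReal.ofReal (v i q))
    fun i ↦ (withDensity_absolutelyContinuous _ _).trans
      Measure.restrict_le_self.absolutelyContinuous
  refine ⟨X, hX, fun i ↦ ?_⟩
  rw [← measureReal_withDensity_ofReal_eq_pieceValue (hv i) (hv₀ i) hC.isCompact.measurableSet
      subset_rfl, ← measureReal_withDensity_ofReal_eq_pieceValue (hv i) (hv₀ i)
      (hX.rectangle i).measurableSet (hX.subset i)]
  exact hle i

end Allocation

section Staircase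

variable {R : ℕ} {p q : ℝ × ℝ}

lemma mem_staircase : p ∈ staircase R ↔
    ∃ k ≤ R, 0 ≤ p.1 ∧ p.1 ≤ (k : ℝ) + 1 ∧ 0 ≤ p.2 ∧ p.2 ≤ (R : ℝ) + 1 - k := by
  simp only [staircase, mem_iUnion, mem_prod, mem_Icc, Finset.mem_range_succ_iff, exists_prop,
    and_assoc]

lemma mem_staircase_of_le (hp : p ∈ staircase R) (hq₁ : 0 ≤ q.1) (hq₂ : 0 ≤ q.2)
    (hqp : q ≤ p) : q ∈ staircase R := by
  obtain ⟨k, hk, -, hp₁, -, hp₂⟩ := mem_staircase.1 hp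
  exact mem_staircase.2 ⟨k, hk, hq₁, hqp.1.trans hp₁, hq₂, hqp.2.trans hp₂⟩

lemma isCompact_staircase (R : ℕ) : IsCompact (staircase R) :=
  (Finset.range (R + 1)).isCompact_biUnion fun _ _ ↦ isCompact_Icc.prod isCompact_Icc

lemma exists_pos_forall_of_eventually {P : ℝ × ℝ → Prop} (h : ∀ᶠ q in 𝓝 p, P q) :
    ∃ ε > 0, ∀ a b : ℝ, |a| ≤ ε → |b| ≤ ε → P (p.1 + a, p.2 + b) := by
  obtain ⟨ε, hε, hP⟩ := Metric.nhds_basis_closedBall.eventually_iff.1 h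
  refine ⟨ε, hε, fun a b ha hb ↦ hP ?_⟩
  simpa [Prod.dist_eq, Real.dist_eq] using ⟨ha, hb⟩

lemma interior_staircase (R : ℕ) : interior (staircase R) =
    ⋃ k ∈ Finset.range (R + 1), Ioo (0 : ℝ) (k + 1) ×ˢ Ioo (0 : ℝ) (R + 1 - k) := by
  refine Subset.antisymm (fun p hp ↦ ?_) (interior_maximal (iUnion₂_mono fun k _ ↦
    prod_mono Ioo_subset_Icc_self Ioo_subset_Icc_self)
    (isOpen_biUnion fun k _ ↦ isOpen_Ioo.prod isOpen_Ioo))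
  obtain ⟨ε, hε, hbox⟩ := exists_pos_forall_of_eventually (mem_interior_iff_mem_nhds.1 hp)
  have hε_abs : |ε| ≤ ε := (abs_of_pos hε).le
  obtain ⟨-, -, hp₁, -, hp₂, -⟩ := mem_staircase.1 (hbox (-ε) (-ε) (by simpa) (by simpa))
  obtain ⟨k, hk, -, hk₁, -, hk₂⟩ := mem_staircase.1 (hbox ε ε hε_abs hε_abs)
  exact mem_biUnion (x := k) (Finset.mem_coe.2 (Finset.mem_range_succ_iff.2 hk))
    ⟨⟨by linarith, by linarith⟩, by linarith, by linarith⟩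

lemma mem_interior_staircase : p ∈ interior (staircase R) ↔
    ∃ k ≤ R, 0 < p.1 ∧ p.1 < (k : ℝ) + 1 ∧ 0 < p.2 ∧ p.2 < (R : ℝ) + 1 - k := by
  simp only [interior_staircase, mem_iUnion, mem_prod, mem_Ioo, Finset.mem_range_succ_iff,
    exists_prop, and_assoc]

lemma closure_interior_staircase (R : ℕ) : closure (interior (staircase R)) = staircase R := by
  rw [interior_staircase, Finset.closure_biUnion, staircase]
  refine iUnion₂_congr fun k hk ↦ ?_
  have hkR : (k : ℝ) ≤ R := mod_cast Finset.mem_range_succ_iff.1 hk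
  rw [closure_prod_eq, closure_Ioo (by positivity), closure_Ioo (by linarith)]

lemma isConnected_interior_staircase (R : ℕ) : IsConnected (interior (staircase R)) := by
  have hcenter (k : ℕ) (hk : k ∈ Finset.range (R + 1)) :
      ((1 / 2, 1 / 2) : ℝ × ℝ) ∈ Ioo (0 : ℝ) (k + 1) ×ˢ Ioo (0 : ℝ) (R + 1 - k) := by
    have hkR : (k : ℝ) ≤ R := mod_cast Finset.mem_range_succ_iff.1 hk
    exact ⟨⟨by norm_num, by linarith [k.cast_nonneg (α := ℝ)]⟩, by norm_num, by linarith⟩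
  rw [interior_staircase]
  refine ⟨⟨_, mem_biUnion (Finset.mem_coe.2 (Finset.mem_range.2 R.succ_pos))
    (hcenter 0 (Finset.mem_range.2 R.succ_pos))⟩, ?_⟩
  simp only [← Finset.mem_coe, ← sUnion_image]
  refine isPreconnected_sUnion _ _ (forall_mem_image.2 hcenter) (forall_mem_image.2 fun k _ ↦ ?_)
  exact isPreconnected_Ioo.prod isPreconnected_Ioo

lemma notMem_interior_staircase {k : ℕ} (hp₁ : (k : ℝ) ≤ p.1) (hp₂ : (R : ℝ) + 1 - k ≤ p.2) :
    p ∉ interior (staircase R) := by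
  rw [mem_interior_staircase]
  rintro ⟨l, -, -, hl₁, -, hl₂⟩
  have hkl : k < l + 1 := by exact_mod_cast hp₁.trans_lt hl₁
  have hlk : l < k := by exact_mod_cast (by linarith : (l : ℝ) < k)
  lia

lemma mem_frontier_staircase_iff :
    p ∈ frontier (staircase R) ↔ p ∈ staircase R ∧ p ∉ interior (staircase R) := by
  rw [(isCompact_staircase R).isClosed.frontier_eq, Set.mem_sdiff]

lemma mem_boundary_of_mem_frontier_staircase (hp : p ∈ frontier (staircase R)) :
    (p.1 = 0 ∧ p.2 ∈ Icc 0 (R + 1 : ℝ)) ∨ (p.2 = 0 ∧ p.1 ∈ Icc 0 (R + 1 : ℝ)) ∨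
    ∃ k ≤ R, (p.1 = R + 1 - k ∧ p.2 ∈ Icc (k : ℝ) (k + 1)) ∨
      (p.1 ∈ Icc (R - k : ℝ) (R + 1 - k) ∧ p.2 = k + 1) := by
  obtain ⟨hpC, hpi⟩ := mem_frontier_staircase_iff.1 hp
  obtain ⟨l, hl, hp₁, hl₁, hp₂, hl₂⟩ := mem_staircase.1 hpC
  have hlR : (l : ℝ) ≤ R := mod_cast hl
  have hl₀ : (0 : ℝ) ≤ l := l.cast_nonneg
  obtain hp₁ | hp₁ := hp₁.eq_or_lt
  · exact .inl ⟨hp₁.symm, hp₂, by linarith⟩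
  obtain hp₂ | hp₂ := hp₂.eq_or_lt
  · exact .inr (.inl ⟨hp₂.symm, hp₁.le, by linarith⟩)
  have hout (m : ℕ) (hm : m ≤ R) (hm₁ : p.1 < m + 1) : (R : ℝ) + 1 - m ≤ p.2 := by
    by_contra! hm₂
    exact hpi (mem_interior_staircase.2 ⟨m, hm, hp₁, hm₁, hp₂, hm₂⟩)
  refine .inr (.inr ⟨R - l, R.sub_le l, ?_⟩)
  rw [Nat.cast_sub hl]
  obtain hl₁ | hl₁ := hl₁.eq_or_lt
  · refine .inl ⟨by linarith, ?_, by linarith⟩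
    obtain rfl | hl := hl.eq_or_lt
    · linarith
    · have := hout (l + 1) hl (by push_cast; linarith)
      push_cast at this
      linarith
  · have hp₂ := hout l hl hl₁
    refine .inr ⟨⟨?_, by linarith⟩, by linarith⟩
    by_contra! hlt
    obtain ⟨m, rfl⟩ : ∃ m, l = m + 1 := Nat.exists_eq_add_one.2 (by
      exact_mod_cast (by linarith : (0 : ℝ) < l))
    have := hout m (by lia) (by push_cast at hlt; linarith)
    push_cast at hl₂
    linarith

lemma mem_frontier_staircase_of_fst_eq_zero (hp₁ : p.1 = 0) (hp₂ : p.2 ∈ Icc 0 (R + 1 : ℝ)) :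
    p ∈ frontier (staircase R) := by
  refine mem_frontier_staircase_iff.2 ⟨mem_staircase.2 ⟨0, R.zero_le, ?_⟩, fun h ↦ ?_⟩
  · simpa [hp₁, zero_le_one] using hp₂
  · obtain ⟨-, -, hpos, -⟩ := mem_interior_staircase.1 h
    exact hpos.ne' hp₁

lemma mem_frontier_staircase_of_snd_eq_zero (hp₂ : p.2 = 0) (hp₁ : p.1 ∈ Icc 0 (R + 1 : ℝ)) :
    p ∈ frontier (staircase R) := by
  refine mem_frontier_staircase_iff.2 ⟨mem_staircase.2 ⟨R, le_rfl, ?_⟩, fun h ↦ ?_⟩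
  · simpa [hp₂, zero_le_one] using hp₁
  · obtain ⟨-, -, -, -, hpos, -⟩ := mem_interior_staircase.1 h
    exact hpos.ne' hp₂

lemma mem_frontier_staircase_of_mem_stair {k : ℕ} (hk : k ≤ R)
    (hp : (p.1 = R + 1 - k ∧ p.2 ∈ Icc (k : ℝ) (k + 1)) ∨
      (p.1 ∈ Icc (R - k : ℝ) (R + 1 - k) ∧ p.2 = k + 1)) : p ∈ frontier (staircase R) := by
  have hkR : (k : ℝ) ≤ R := mod_cast hk
  have hk₀ : (0 : ℝ) ≤ k := k.cast_nonneg
  refine mem_frontier_staircase_iff.2 ⟨mem_staircase.2 ⟨R - k, R.sub_le k, ?_⟩, ?_⟩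
  · rw [Nat.cast_sub hk]
    grind
  · rcases hp with ⟨hp₁, hp₂, -⟩ | ⟨⟨hp₁, -⟩, hp₂⟩
    · refine notMem_interior_staircase (k := R + 1 - k) ?_ ?_ <;>
        rw [Nat.cast_sub (by lia), Nat.cast_succ] <;> linarith
    · refine notMem_interior_staircase (k := R - k) ?_ ?_ <;> rw [Nat.cast_sub hk] <;> linarith

lemma mem_frontier_staircase : p ∈ frontier (staircase R) ↔
    (p.1 = 0 ∧ p.2 ∈ Icc 0 (R + 1 : ℝ)) ∨ (p.2 = 0 ∧ p.1 ∈ Icc 0 (R + 1 : ℝ)) ∨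
    ∃ k ≤ R, (p.1 = R + 1 - k ∧ p.2 ∈ Icc (k : ℝ) (k + 1)) ∨
      (p.1 ∈ Icc (R - k : ℝ) (R + 1 - k) ∧ p.2 = k + 1) := by
  refine ⟨mem_boundary_of_mem_frontier_staircase, ?_⟩
  rintro (⟨hp₁, hp₂⟩ | ⟨hp₂, hp₁⟩ | ⟨k, hk, hp⟩)
  · exact mem_frontier_staircase_of_fst_eq_zero hp₁ hp₂
  · exact mem_frontier_staircase_of_snd_eq_zero hp₂ hp₁
  · exact mem_frontier_staircase_of_mem_stair hk hp

section Polygon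

/-- The boundary of the staircase: its corners in counterclockwise order, from the lower right one
up the stairs to the upper left one, and finally the origin. -/
noncomputable def staircasePolygon (R : ℕ) : Polygon (ℝ × ℝ) (2 * R + 4) :=
  ⟨fun i ↦ (R + 1 - (i / 2 : ℕ), (if (i : ℕ) = 2 * R + 3 then 0 else (i + 1) / 2 : ℕ))⟩

variable {i j : Fin (2 * R + 4)} {k : ℕ}

lemma val_finRotate (i : Fin (2 * R + 4)) :
    (finRotate _ i : ℕ) = if (i : ℕ) = 2 * R + 3 then 0 else (i : ℕ) + 1 := by
  rw [coe_finRotate]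
  simp [Fin.ext_iff]

lemma fst_staircasePolygon_finRotate (hi : Even (i : ℕ)) :
    (staircasePolygon R (finRotate _ i)).1 = (staircasePolygon R i).1 := by
  have hdiv : (finRotate _ i : ℕ) / 2 = i / 2 := by
    rw [val_finRotate]
    grind
  simp only [staircasePolygon, hdiv]

lemma snd_staircasePolygon_finRotate (hi : Odd (i : ℕ)) :
    (staircasePolygon R (finRotate _ i)).2 = (staircasePolygon R i).2 := by
  simp only [staircasePolygon, val_finRotate, Nat.cast_inj]
  grind

lemma perpendicular_staircasePolygon (i : Fin (2 * R + 4)) :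
    ((staircasePolygon R i).1 = (staircasePolygon R (finRotate _ i)).1 ∧
        (staircasePolygon R (finRotate _ i)).2 =
          (staircasePolygon R (finRotate _ (finRotate _ i))).2) ∨
      ((staircasePolygon R i).2 = (staircasePolygon R (finRotate _ i)).2 ∧
        (staircasePolygon R (finRotate _ i)).1 =
          (staircasePolygon R (finRotate _ (finRotate _ i))).1) := by
  have hparity : Even (finRotate _ i : ℕ) ↔ Odd (i : ℕ) := by
    rw [val_finRotate]
    grind
  rcases Nat.even_or_odd (i : ℕ) with hi | hi
  · refine .inl ⟨(fst_staircasePolygon_finRotate hi).symm, (snd_staircasePolygon_finRotate ?_).symm⟩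
    rwa [← Nat.not_even_iff_odd, hparity, Nat.not_odd_iff_even]
  · exact .inr ⟨(snd_staircasePolygon_finRotate hi).symm,
      (fst_staircasePolygon_finRotate (hparity.2 hi)).symm⟩

lemma hasNondegenerateEdges_staircasePolygon (R : ℕ) :
    (staircasePolygon R).HasNondegenerateEdges := by
  intro i hi
  simp only [staircasePolygon, Prod.mk.injEq, sub_right_inj, Nat.cast_inj, val_finRotate] at hi
  grind

lemma affineSegment_eq_uIcc {a b : ℝ × ℝ} (h : a.1 = b.1 ∨ a.2 = b.2) :
    affineSegment ℝ a b = uIcc a b := by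
  obtain ⟨a₁, a₂⟩ := a
  obtain ⟨b₁, b₂⟩ := b
  obtain rfl | rfl : a₁ = b₁ ∨ a₂ = b₂ := h
  · rw [affineSegment_eq_segment, ← Prod.image_mk_segment_right, segment_eq_uIcc, uIcc_prod_eq,
      uIcc_self, singleton_prod]
  · rw [affineSegment_eq_segment, ← Prod.image_mk_segment_left, segment_eq_uIcc, uIcc_prod_eq,
      uIcc_self, prod_singleton]

lemma edgeSet_staircasePolygon (i : Fin (2 * R + 4)) : (staircasePolygon R).edgeSet ℝ i =
    uIcc (staircasePolygon R i) (staircasePolygon R (finRotate _ i)) :=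
  affineSegment_eq_uIcc ((perpendicular_staircasePolygon i).imp And.left And.left)

lemma mem_edgeSet_staircasePolygon_of_even (hi : (i : ℕ) = 2 * k) (hk : k ≤ R) :
    p ∈ (staircasePolygon R).edgeSet ℝ i ↔ p.1 = R + 1 - k ∧ p.2 ∈ Icc (k : ℝ) (k + 1) := by
  have hdiv : (2 * k + 1) / 2 = k := by lia
  have hdiv' : (2 * k + 1 + 1) / 2 = k + 1 := by lia
  rw [edgeSet_staircasePolygon, uIcc_prod_eq, mem_prod]
  simp only [staircasePolygon, val_finRotate, hi]
  rw [if_neg (by lia), if_neg (by lia), if_neg (by lia), hdiv, hdiv',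
    Nat.mul_div_cancel_left k two_pos, uIcc_self, mem_singleton_iff, Nat.cast_succ,
    uIcc_of_le (by linarith)]

lemma mem_edgeSet_staircasePolygon_of_odd (hi : (i : ℕ) = 2 * k + 1) (hk : k ≤ R) :
    p ∈ (staircasePolygon R).edgeSet ℝ i ↔
      p.1 ∈ Icc (R - k : ℝ) (R + 1 - k) ∧ p.2 = k + 1 := by
  have hdiv : (2 * k + 1) / 2 = k := by lia
  have hdiv' : (2 * k + 1 + 1) / 2 = k + 1 := by lia
  have hsub : (R : ℝ) + 1 - (k + 1) = R - k := by ring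
  rw [edgeSet_staircasePolygon, uIcc_prod_eq, mem_prod,
    snd_staircasePolygon_finRotate (hi ▸ odd_two_mul_add_one k), uIcc_self, mem_singleton_iff]
  simp only [staircasePolygon, val_finRotate, hi]
  rw [if_neg (by lia), if_neg (by lia), hdiv, hdiv', Nat.cast_succ, hsub,
    uIcc_of_ge (by linarith)]

lemma mem_edgeSet_staircasePolygon_left (hi : (i : ℕ) = 2 * R + 2) :
    p ∈ (staircasePolygon R).edgeSet ℝ i ↔ p.1 = 0 ∧ p.2 ∈ Icc 0 (R + 1 : ℝ) := by
  have hdiv : (2 * R + 2) / 2 = R + 1 := by lia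
  have hdiv' : (2 * R + 2 + 1) / 2 = R + 1 := by lia
  rw [edgeSet_staircasePolygon, uIcc_prod_eq, mem_prod]
  simp only [staircasePolygon, val_finRotate, hi]
  rw [if_neg (by lia), if_neg (by lia), if_pos rfl, hdiv, hdiv', uIcc_self, mem_singleton_iff,
    Nat.cast_succ, sub_self, Nat.cast_zero, uIcc_of_ge (by positivity)]

lemma mem_edgeSet_staircasePolygon_bottom (hi : (i : ℕ) = 2 * R + 3) :
    p ∈ (staircasePolygon R).edgeSet ℝ i ↔ p.2 = 0 ∧ p.1 ∈ Icc 0 (R + 1 : ℝ) := by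
  have hdiv : (2 * R + 3) / 2 = R + 1 := by lia
  rw [edgeSet_staircasePolygon, uIcc_prod_eq, mem_prod, and_comm]
  simp only [staircasePolygon, val_finRotate, hi, if_true]
  rw [if_neg (by lia), hdiv, Nat.zero_div, Nat.zero_add, Nat.cast_zero,
    Nat.cast_succ, sub_self, sub_zero, uIcc_self,
    mem_singleton_iff, uIcc_of_le (by positivity)]

lemma frontier_staircase (R : ℕ) :
    frontier (staircase R) = (staircasePolygon R).boundary ℝ := by
  ext p
  simp only [Polygon.boundary, mem_iUnion]
  rw [mem_frontier_staircase]
  constructor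
  · rintro (hp | hp | ⟨k, hk, hp | hp⟩)
    · exact ⟨⟨2 * R + 2, by lia⟩, (mem_edgeSet_staircasePolygon_left rfl).2 hp⟩
    · exact ⟨⟨2 * R + 3, by lia⟩, (mem_edgeSet_staircasePolygon_bottom rfl).2 hp⟩
    · exact ⟨⟨2 * k, by lia⟩, (mem_edgeSet_staircasePolygon_of_even rfl hk).2 hp⟩
    · exact ⟨⟨2 * k + 1, by lia⟩, (mem_edgeSet_staircasePolygon_of_odd rfl hk).2 hp⟩
  · rintro ⟨i, hp⟩
    obtain hi | hi | ⟨k, hk, hi | hi⟩ : (i : ℕ) = 2 * R + 2 ∨ (i : ℕ) = 2 * R + 3 ∨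
        ∃ k ≤ R, (i : ℕ) = 2 * k ∨ (i : ℕ) = 2 * k + 1 := by
      by_cases hiR : (i : ℕ) / 2 ≤ R
      · exact .inr (.inr ⟨_, hiR, by lia⟩)
      · lia
    · exact .inl ((mem_edgeSet_staircasePolygon_left hi).1 hp)
    · exact .inr (.inl ((mem_edgeSet_staircasePolygon_bottom hi).1 hp))
    · exact .inr (.inr ⟨k, hk, .inl ((mem_edgeSet_staircasePolygon_of_even hi hk).1 hp)⟩)
    · exact .inr (.inr ⟨k, hk, .inr ((mem_edgeSet_staircasePolygon_of_odd hi hk).1 hp)⟩)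

-- The antidiagonal coordinate `p.2 - p.1` increases along the stairs, by one on every edge.
lemma bounds_of_mem_edgeSet_staircasePolygon (hi : (i : ℕ) ≤ 2 * R + 1)
    (hp : p ∈ (staircasePolygon R).edgeSet ℝ i) :
    p.2 - p.1 + R + 1 ∈ Icc (i : ℝ) (i + 1) ∧ (i : ℝ) ≤ 2 * p.2 ∧ 2 * R + 1 - i ≤ 2 * p.1 := by
  obtain ⟨k, hik⟩ := Nat.even_or_odd' (i : ℕ)
  obtain hik | hik := hik
  · obtain ⟨hp₁, hp₂⟩ := (mem_edgeSet_staircasePolygon_of_even hik (by lia)).1 hp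
    rw [hik, mem_Icc]
    push_cast
    grind
  · obtain ⟨hp₁, hp₂⟩ := (mem_edgeSet_staircasePolygon_of_odd hik (by lia)).1 hp
    rw [hik, mem_Icc]
    push_cast
    grind

lemma disjoint_edgeSet_staircasePolygon (hij : i ≠ j) (hj : j ≠ finRotate _ i)
    (hi : i ≠ finRotate _ j) :
    Disjoint ((staircasePolygon R).edgeSet ℝ i) ((staircasePolygon R).edgeSet ℝ j) := by
  wlog hlt : i < j generalizing i j
  · exact (this hij.symm hi hj (hij.lt_or_gt.resolve_left hlt)).symm
  simp only [ne_eq, Fin.ext_iff, val_finRotate] at hi hj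
  rw [Fin.lt_def] at hlt
  refine disjoint_left.2 fun p hpi hpj ↦ ?_
  obtain ⟨⟨-, hi₁⟩, hi₂, hi₃⟩ := bounds_of_mem_edgeSet_staircasePolygon (by grind) hpi
  obtain hj' | hj' | hj' : (j : ℕ) ≤ 2 * R + 1 ∨ (j : ℕ) = 2 * R + 2 ∨ (j : ℕ) = 2 * R + 3 := by
    lia
  · obtain ⟨⟨hj₁, -⟩, -⟩ := bounds_of_mem_edgeSet_staircasePolygon hj' hpj
    have : (i : ℝ) + 2 ≤ j := mod_cast (by grind : (i : ℕ) + 2 ≤ j)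
    linarith
  · have := ((mem_edgeSet_staircasePolygon_left hj').1 hpj).1
    have : (i : ℝ) ≤ 2 * R := mod_cast (by grind : (i : ℕ) ≤ 2 * R)
    linarith
  · have := ((mem_edgeSet_staircasePolygon_bottom hj').1 hpj).1
    have : (1 : ℝ) ≤ i := mod_cast (by grind : 1 ≤ (i : ℕ))
    linarith

end Polygon

lemma isSimpleRectilinearChain_staircasePolygon (R : ℕ) :
    IsSimpleRectilinearChain (staircasePolygon R) :=
  ⟨hasNondegenerateEdges_staircasePolygon R, perpendicular_staircasePolygon,
    fun _ _ ↦ disjoint_edgeSet_staircasePolygon⟩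

lemma isRectilinearPolygon_staircase (R : ℕ) : IsRectilinearPolygon (staircase R) :=
  ⟨isCompact_staircase R, closure_interior_staircase R, isConnected_interior_staircase R,
    2 * R + 4, staircasePolygon R, isSimpleRectilinearChain_staircasePolygon R,
    frontier_staircase R⟩

section ReflexVertices

-- Since the staircase is downward closed, the missing quadrant can only be the upper right one.
lemma exists_pos_forall_mem_staircase_iff (hp : p ∈ reflexVertices (staircase R)) :
    ∃ ε > 0, ∀ a b : ℝ, |a| ≤ ε → |b| ≤ ε →
      ((p.1 + a, p.2 + b) ∈ staircase R ↔ a ≤ 0 ∨ b ≤ 0) := by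
  obtain ⟨s, t, hs, ht, hst⟩ := hp
  obtain ⟨ε, hε, hbox⟩ := exists_pos_forall_of_eventually hst
  simp only [add_sub_cancel_left] at hbox
  have hε_abs : |ε| ≤ ε := (abs_of_pos hε).le
  have hs_abs : |s * ε| ≤ ε := by rcases hs with rfl | rfl <;> simpa
  have ht_abs : |t * ε| ≤ ε := by rcases ht with rfl | rfl <;> simpa
  have hss : s * (s * ε) = ε := by rcases hs with rfl | rfl <;> ring
  have htt : t * (t * ε) = ε := by rcases ht with rfl | rfl <;> ring
  have hnot : (p.1 + -(s * ε), p.2 + -(t * ε)) ∉ staircase R := by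
    rw [hbox _ _ (by rwa [abs_neg]) (by rwa [abs_neg])]
    simp only [mul_neg, hss, htt]
    grind
  have hright : (p.1 + s * ε, p.2 + -(t * ε)) ∈ staircase R :=
    (hbox _ _ hs_abs (by rwa [abs_neg])).2 (.inl (by rw [hss]; exact hε.le))
  have hup : (p.1 + -(s * ε), p.2 + t * ε) ∈ staircase R :=
    (hbox _ _ (by rwa [abs_neg]) ht_abs).2 (.inr (by rw [htt]; exact hε.le))
  have hright₂ : 0 ≤ p.2 + -(t * ε) := by grind [mem_staircase]
  have hup₁ : 0 ≤ p.1 + -(s * ε) := by grind [mem_staircase]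
  obtain rfl : s = -1 := hs.resolve_left fun hs ↦ hnot <|
    mem_staircase_of_le hright hup₁ hright₂ ⟨by simp only [hs]; linarith, le_rfl⟩
  obtain rfl : t = -1 := ht.resolve_left fun ht ↦ hnot <|
    mem_staircase_of_le hup hup₁ hright₂ ⟨le_rfl, by simp only [ht]; linarith⟩
  exact ⟨ε, hε, fun a b ha hb ↦ by simpa using hbox a b ha hb⟩

lemma notMem_interior_of_mem_reflexVertices (hp : p ∈ reflexVertices (staircase R)) :
    p ∉ interior (staircase R) := by
  obtain ⟨ε, hε, hbox⟩ := exists_pos_forall_mem_staircase_iff hp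
  intro h
  obtain ⟨δ, hδ, hδbox⟩ := exists_pos_forall_of_eventually (mem_interior_iff_mem_nhds.1 h)
  have hmin : 0 < min δ ε := lt_min hδ hε
  have hmin_abs : |min δ ε| = min δ ε := abs_of_pos hmin
  have hmem : (p.1 + min δ ε, p.2 + min δ ε) ∈ staircase R :=
    hδbox _ _ (hmin_abs.trans_le (min_le_left _ _)) (hmin_abs.trans_le (min_le_left _ _))
  rw [hbox _ _ (hmin_abs.trans_le (min_le_right _ _)) (hmin_abs.trans_le (min_le_right _ _)),
    or_self] at hmem
  exact hmin.not_ge hmem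

lemma reflexVertices_staircase_subset (R : ℕ) : reflexVertices (staircase R) ⊆
    (fun k : ℕ ↦ ((k : ℝ), (R : ℝ) + 1 - k)) '' Icc 1 R := by
  intro p hp
  obtain ⟨ε, hε, hbox⟩ := exists_pos_forall_mem_staircase_iff hp
  have hε_abs : |ε| ≤ ε := (abs_of_pos hε).le
  have hzero : |(0 : ℝ)| ≤ ε := by simpa using hε.le
  have hlow : (p.1 + -ε, p.2 + -ε) ∈ staircase R :=
    (hbox _ _ (by simpa) (by simpa)).2 (.inl (by linarith))
  obtain ⟨-, -, hp₁, -, hp₂, -⟩ := mem_staircase.1 hlow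
  obtain ⟨k, hk, -, hk₁, -, hk₂⟩ := mem_staircase.1 ((hbox _ _ hε_abs hzero).2 (.inr le_rfl))
  obtain ⟨l, hl, -, hl₁, -, hl₂⟩ := mem_staircase.1 ((hbox _ _ hzero hε_abs).2 (.inl le_rfl))
  simp only [add_zero] at hp₁ hp₂ hk₁ hk₂ hl₁ hl₂
  have hout (m : ℕ) (hm : m ≤ R) : (m : ℝ) + 1 ≤ p.1 ∨ (R : ℝ) + 1 - m ≤ p.2 := by
    by_contra! hlt
    exact notMem_interior_of_mem_reflexVertices hp (mem_interior_staircase.2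
      ⟨m, hm, by linarith, hlt.1, by linarith, hlt.2⟩)
  have hp₂_eq : p.2 = R + 1 - k :=
    hk₂.antisymm ((hout k hk).resolve_left (by linarith))
  have hp₁_eq : p.1 = l + 1 :=
    hl₁.antisymm ((hout l hl).resolve_right (by linarith))
  have hlk : l < k := by exact_mod_cast (by linarith : (l : ℝ) < k)
  have hkl : k ≤ l + 1 := by
    have := (hout (l + 1) (by lia)).resolve_left (by push_cast; linarith)
    rw [hp₂_eq, sub_le_sub_iff_left] at this
    exact_mod_cast this
  obtain rfl : k = l + 1 := by lia
  exact ⟨l + 1, ⟨by lia, hk⟩, Prod.ext (hp₁_eq.trans (l.cast_succ).symm).symm hp₂_eq.symm⟩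

lemma mem_reflexVertices_staircase {k : ℕ} (hk : k ∈ Icc 1 R) :
    ((k : ℝ), (R : ℝ) + 1 - k) ∈ reflexVertices (staircase R) := by
  obtain ⟨hk₁, hkR⟩ := hk
  have hk₁' : (1 : ℝ) ≤ k := mod_cast hk₁
  have hkR' : (k : ℝ) ≤ R := mod_cast hkR
  refine ⟨-1, -1, .inr rfl, .inr rfl, ?_⟩
  have hbox : Ioo ((k : ℝ) - 1) (k + 1) ×ˢ Ioo ((R : ℝ) - k) (R + 2 - k) ∈
      𝓝 ((k : ℝ), (R : ℝ) + 1 - k) :=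
    prod_mem_nhds (Ioo_mem_nhds (by linarith) (by linarith))
      (Ioo_mem_nhds (by linarith) (by linarith))
  filter_upwards [hbox] with q ⟨⟨hq₁, hq₁'⟩, hq₂, hq₂'⟩
  rw [mem_staircase]
  constructor
  · rintro ⟨l, -, -, hl₁, -, hl₂⟩
    obtain hlk | hkl := Nat.lt_or_ge l k
    · have : (l : ℝ) + 1 ≤ k := mod_cast hlk
      exact .inl (by linarith)
    · have : (k : ℝ) ≤ l := mod_cast hkl
      exact .inr (by linarith)
  · rintro (h | h)
    · refine ⟨k - 1, by lia, ?_⟩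
      rw [Nat.cast_pred hk₁]
      exact ⟨by linarith, by linarith, by linarith, by linarith⟩
    · exact ⟨k, hkR, by linarith, by linarith, by linarith, by linarith⟩

lemma reflexVertices_staircase (R : ℕ) : reflexVertices (staircase R) =
    (fun k : ℕ ↦ ((k : ℝ), (R : ℝ) + 1 - k)) '' Icc 1 R :=
  (reflexVertices_staircase_subset R).antisymm
    (image_subset_iff.2 fun _ ↦ mem_reflexVertices_staircase)

lemma encard_reflexVertices_staircase (R : ℕ) : (reflexVertices (staircase R)).encard = R := by
  have hinj : Function.Injective fun k : ℕ ↦ ((k : ℝ), (R : ℝ) + 1 - k) :=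
    fun k l h ↦ Nat.cast_injective (Prod.ext_iff.1 h).1
  rw [reflexVertices_staircase, hinj.encard_image, ← Finset.coe_Icc, encard_coe_eq_coe_finsetCard,
    Nat.card_Icc, Nat.add_sub_cancel]

end ReflexVertices

end Staircase

section CornerDensity

/-- The open unit square below the `k`-th outer corner of the staircase. -/
def cornerCell (R k : ℕ) : Set (ℝ × ℝ) :=
  Ioo (k : ℝ) (k + 1) ×ˢ Ioo (R - k : ℝ) (R + 1 - k)

/-- The value of the `k`-th corner cell in the extremal example: the last cell alone is worth as
much as there are agents, so that some agent gets at most one if all of them share it. -/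
noncomputable def cornerWeight (n R k : ℕ) : ℝ := if k = R then n else 1

/-- The value-density of the extremal example, which has total value `cornerWeight n R k` on
`cornerCell R k` and vanishes elsewhere. -/
noncomputable def cornerDensity (n R : ℕ) (p : ℝ × ℝ) : ℝ :=
  ∑ k ∈ Finset.range (R + 1), (cornerCell R k).indicator (fun _ ↦ cornerWeight n R k) p

variable {n R k l : ℕ} {X : Set (ℝ × ℝ)}

lemma measurableSet_cornerCell (R k : ℕ) : MeasurableSet (cornerCell R k) :=
  measurableSet_Ioo.prod measurableSet_Ioo

lemma volume_cornerCell (R k : ℕ) : volume (cornerCell R k) = 1 := by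
  have hside : (R : ℝ) + 1 - k - (R - k) = 1 := by ring
  rw [cornerCell, Measure.volume_eq_prod, Measure.prod_prod, Real.volume_Ioo, Real.volume_Ioo,
    add_sub_cancel_left, hside, ENNReal.ofReal_one, one_mul]

lemma volume_real_inter_cornerCell_le_one (X : Set (ℝ × ℝ)) (k : ℕ) :
    volume.real (X ∩ cornerCell R k) ≤ 1 :=
  ENNReal.toReal_le_of_le_ofReal zero_le_one <| by
    rw [ENNReal.ofReal_one, ← volume_cornerCell R k]
    exact measure_mono inter_subset_right

lemma cornerCell_subset_staircase (hk : k ≤ R) : cornerCell R k ⊆ staircase R := by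
  rintro p ⟨⟨hp₁, hp₁'⟩, hp₂, hp₂'⟩
  have hkR : (k : ℝ) ≤ R := mod_cast hk
  exact mem_staircase.2
    ⟨k, hk, k.cast_nonneg.trans hp₁.le, hp₁'.le, (sub_nonneg.2 hkR).trans hp₂.le, hp₂'.le⟩

lemma cornerWeight_nonneg (n R k : ℕ) : 0 ≤ cornerWeight n R k := by
  unfold cornerWeight
  split_ifs <;> positivity

lemma integrable_indicator_cornerCell (R k : ℕ) (c : ℝ) :
    Integrable ((cornerCell R k).indicator fun _ ↦ c) :=
  (integrable_indicator_iff (measurableSet_cornerCell R k)).2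
    (integrableOn_const (by simp [volume_cornerCell]))

lemma isValueDensity_cornerDensity (n R : ℕ) (C : Set (ℝ × ℝ)) :
    IsValueDensity C (cornerDensity n R) where
  integrable := (integrable_finsetSum _ fun _ _ ↦
    integrable_indicator_cornerCell R _ _).integrableOn
  nonneg p _ := Finset.sum_nonneg fun k _ ↦ indicator_nonneg (fun _ _ ↦ cornerWeight_nonneg n R k) p
  bounded := ⟨∑ k ∈ Finset.range (R + 1), cornerWeight n R k, fun p _ ↦ Finset.sum_le_sum fun k _ ↦
    indicator_le_self' (fun _ _ ↦ cornerWeight_nonneg n R k) p⟩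

lemma pieceValue_cornerDensity (X : Set (ℝ × ℝ)) : pieceValue (cornerDensity n R) X =
    ∑ k ∈ Finset.range (R + 1), cornerWeight n R k * volume.real (X ∩ cornerCell R k) := by
  unfold pieceValue cornerDensity
  rw [integral_finsetSum _ fun _ _ ↦ (integrable_indicator_cornerCell R _ _).integrableOn]
  refine Finset.sum_congr rfl fun k _ ↦ ?_
  rw [integral_indicator_const _ (measurableSet_cornerCell R k), smul_eq_mul, mul_comm,
    measureReal_restrict_apply (measurableSet_cornerCell R k), inter_comm]

lemma pieceValue_cornerDensity_staircase (n R : ℕ) :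
    pieceValue (cornerDensity n R) (staircase R) = n + R := by
  have hcell (k : ℕ) (hk : k ≤ R) : volume.real (staircase R ∩ cornerCell R k) = 1 := by
    rw [inter_eq_right.2 (cornerCell_subset_staircase hk), measureReal_def, volume_cornerCell,
      ENNReal.toReal_one]
  have hweight (k : ℕ) (hk : k ∈ Finset.range R) :
      cornerWeight n R k * volume.real (staircase R ∩ cornerCell R k) = 1 := by
    rw [Finset.mem_range] at hk
    rw [hcell k hk.le, cornerWeight, if_neg hk.ne, one_mul]
  rw [pieceValue_cornerDensity, Finset.sum_range_succ, Finset.sum_congr rfl hweight, hcell R le_rfl,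
    cornerWeight, if_pos rfl, Finset.sum_const, Finset.card_range, nsmul_one, mul_one, add_comm]

lemma IsRectangle.eq_of_nonempty_inter_cornerCell (hX : IsRectangle X) (hXC : X ⊆ staircase R)
    (hk : (X ∩ cornerCell R k).Nonempty) (hl : (X ∩ cornerCell R l).Nonempty) : k = l := by
  wlog hkl : k ≤ l generalizing k l
  · exact (this hl hk (le_of_not_ge hkl)).symm
  obtain ⟨I, J, -, -, -, -, rfl⟩ := hX
  obtain ⟨p, ⟨-, hpJ⟩, -, hp, -⟩ := hk
  obtain ⟨q, ⟨hqI, -⟩, ⟨hq, -⟩, -⟩ := hl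
  -- The point `(q.1, p.2)` of the rectangle lies in the staircase only if `l ≤ k`.
  obtain ⟨m, -, -, hm₁, -, hm₂⟩ := mem_staircase.1 (hXC (mk_mem_prod hqI hpJ))
  have hlm : l < m + 1 := by exact_mod_cast hq.trans_le hm₁
  have hmk : m < k + 1 := by
    exact_mod_cast (by linarith [hp.trans_le hm₂] : (m : ℝ) < k + 1)
  lia

lemma IsRectangle.exists_pieceValue_cornerDensity_eq (hX : IsRectangle X)
    (hXC : X ⊆ staircase R) : ∃ k, pieceValue (cornerDensity n R) X =
      cornerWeight n R k * volume.real (X ∩ cornerCell R k) := by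
  obtain ⟨k, hk, hother⟩ : ∃ k ∈ Finset.range (R + 1), ∀ l ∈ Finset.range (R + 1), l ≠ k →
      X ∩ cornerCell R l = ∅ := by
    by_cases! h : ∃ k ∈ Finset.range (R + 1), (X ∩ cornerCell R k).Nonempty
    · obtain ⟨k, hk, hne⟩ := h
      refine ⟨k, hk, fun l _ hlk ↦ not_nonempty_iff_eq_empty.1 fun hl ↦ hlk ?_⟩
      exact hX.eq_of_nonempty_inter_cornerCell hXC hl hne
    · exact ⟨R, Finset.self_mem_range_succ R, fun l hl _ ↦ h l hl⟩
  refine ⟨k, ?_⟩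
  rw [pieceValue_cornerDensity]
  refine Finset.sum_eq_single_of_mem k hk fun l hl hlk ↦ ?_
  rw [hother l hl hlk, measureReal_empty, mul_zero]

lemma IsRectangle.pieceValue_cornerDensity_eq (hX : IsRectangle X) (hXC : X ⊆ staircase R)
    (hv : 1 < pieceValue (cornerDensity n R) X) :
    pieceValue (cornerDensity n R) X = n * volume.real (X ∩ cornerCell R R) := by
  obtain ⟨k, hk⟩ := hX.exists_pieceValue_cornerDensity_eq (n := n) hXC
  rw [cornerWeight] at hk
  split_ifs at hk with hkR
  · rwa [hkR] at hk
  · rw [hk, one_mul] at hv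
    exact absurd hv (volume_real_inter_cornerCell_le_one X k).not_gt

lemma sum_volume_real_inter_cornerCell_le_one {X : Fin n → Set (ℝ × ℝ)} {C : Set (ℝ × ℝ)}
    (hX : IsRectangularAllocation C X) (k : ℕ) :
    ∑ i, volume.real (X i ∩ cornerCell R k) ≤ 1 := by
  have hfin (i : Fin n) : volume (X i ∩ cornerCell R k) ≠ ⊤ :=
    measure_ne_top_of_subset inter_subset_right (by simp [volume_cornerCell])
  rw [← measureReal_iUnion_fintype
    (fun i j hij ↦ (hX.disjoint i j hij).mono inter_subset_left inter_subset_left)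
    (fun i ↦ (hX.rectangle i).measurableSet.inter (measurableSet_cornerCell R k)) hfin,
    ← iUnion_inter]
  exact volume_real_inter_cornerCell_le_one _ k

theorem exists_pieceValue_cornerDensity_le_one (hn : 1 ≤ n) {X : Fin n → Set (ℝ × ℝ)}
    (hX : IsRectangularAllocation (staircase R) X) :
    ∃ i, pieceValue (cornerDensity n R) (X i) ≤ 1 := by
  by_contra! hlt
  have : NeZero n := ⟨by lia⟩
  have : (n : ℝ) < n :=
    calc (n : ℝ) = ∑ _i : Fin n, (1 : ℝ) := by simp
      _ < ∑ i, pieceValue (cornerDensity n R) (X i) :=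
        Finset.sum_lt_sum_of_nonempty Finset.univ_nonempty fun i _ ↦ hlt i
      _ = n * ∑ i, volume.real (X i ∩ cornerCell R R) := by
        rw [Finset.mul_sum]
        exact Finset.sum_congr rfl fun i _ ↦
          (hX.rectangle i).pieceValue_cornerDensity_eq (hX.subset i) (hlt i)
      _ ≤ n := mul_le_of_le_one_right n.cast_nonneg (sum_volume_real_inter_cornerCell_le_one hX R)
  exact this.false

end CornerDensity

lemma CanGuarantee.le_of_exists_pieceValue_le {n R : ℕ} {c q : ℝ} (hc : CanGuarantee n R c)
    {C : Set (ℝ × ℝ)} (hC : IsRectilinearPolygon C) (hR : (reflexVertices C).encard = R)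
    {w : ℝ × ℝ → ℝ} (hw : IsValueDensity C w) (hpos : 0 < pieceValue w C)
    (hle : ∀ X : Fin n → Set (ℝ × ℝ), IsRectangularAllocation C X →
      ∃ i, pieceValue w (X i) ≤ q * pieceValue w C) : c ≤ q := by
  obtain ⟨X, hX, hcX⟩ := hc C hC hR (fun _ ↦ w) fun _ ↦ hw
  obtain ⟨i, hi⟩ := hle X hX
  exact le_of_mul_le_mul_right ((hcX i).trans hi) hpos

theorem mainTheorem8_general (n : ℕ) (hn : 1 ≤ n) (R : ℕ) :
    CanGuaranteeRegion n R (1 / ((n : ℝ) + (R : ℝ))) ∧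
    (IsRectilinearPolygon (staircase R) ∧ (reflexVertices (staircase R)).encard = R ∧
      ∃ w : ℝ × ℝ → ℝ, IsValueDensity (staircase R) w ∧ 0 < pieceValue w (staircase R) ∧
        ∀ X : Fin n → Set (ℝ × ℝ), IsRectangularAllocation (staircase R) X →
          ∃ i, pieceValue w (X i) ≤ 1 / ((n : ℝ) + (R : ℝ)) * pieceValue w (staircase R)) := by
  have hpos : 0 < (n : ℝ) + R := by positivity
  refine ⟨canGuaranteeRegion_one_div n R, isRectilinearPolygon_staircase R,
    encard_reflexVertices_staircase R, cornerDensity n R, isValueDensity_cornerDensity n R _, ?_⟩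
  rw [pieceValue_cornerDensity_staircase, one_div_mul_cancel hpos.ne']
  exact ⟨hpos, fun X hX ↦ exists_pieceValue_cornerDensity_le_one hn hX⟩

theorem mainTheorem8 (n : ℕ) (hn : 1 ≤ n) (R : ℕ) :
    IsGreatest {c : ℝ | CanGuarantee n R c} (1 / ((n : ℝ) + (R : ℝ))) ∧
    (IsRectilinearPolygon (staircase R) ∧ (reflexVertices (staircase R)).encard = R ∧
      ∃ w : ℝ × ℝ → ℝ, IsValueDensity (staircase R) w ∧ 0 < pieceValue w (staircase R) ∧
        ∀ X : Fin n → Set (ℝ × ℝ), IsRectangularAllocation (staircase R) X →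
          ∃ i, pieceValue w (X i) ≤ 1 / ((n : ℝ) + (R : ℝ)) * pieceValue w (staircase R)) := by
  obtain ⟨hregion, hpoly, hreflex, w, hw, hpos, hle⟩ := mainTheorem8_general n hn R
  exact ⟨⟨hregion.canGuarantee, fun c hc ↦
    hc.le_of_exists_pieceValue_le hpoly hreflex hw hpos hle⟩, hpoly, hreflex, w, hw, hpos, hle⟩
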